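/- Let $m \ge 0$ be an integer. For $k \ge 1$ put $N_k(m) = \frac1k \sum_{r \mid k} \varphi(r)\, m^{k/r}$, where $\varphi$ is Euler's totient function, and let $$\eta_m(t) = \prod_{k=1}^{\infty} \left(\frac{1}{1-t^k}\right)^{N_k(m)},$$ an infinite product of formal power series in $t$ with integer coefficients. For a partition $\lambda$ write $|\lambda|$ for the sum of its parts and $\ell(\lambda)$ for the number of its parts. For $n \ge \ell(\lambda)$ let $F^\lambda_n$ be the finite-dimensional irreducible polynomial representation of $\mathrm{GL}_n(\mathbb C)$ with highest weight $\lambda$. For a partition $\lambda$ and an $m$-tuple of partitions $\boldsymbol\mu = (\mu^{(1)},\dots,\mu^{(m)})$, let $c^\lambda_{\boldsymbol\mu}$ be the multiplicity of $F^\lambda_n$ in $F^{\mu^{(1)}}_n \otimes \cdots \otimes F^{\mu^{(m)}}_n$ under the diagonal action of $\mathrm{GL}_n(\mathbb C)$, where $n = n(\lambda,\boldsymbol\mu)$ is any integer with $n \ge \ell(\lambda)$ and $n \ge \ell(\mu^{(j)})$ for all $j$. Then: 1. For every $k \ge 1$, $N_k(m)$ is a non-negative integer, equal to the number of $k$-bead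 necklaces with beads colored by $m$ colors, counted up to rotation. 2. The product defining $\eta_m(t)$ converges, and for every $d \ge 0$ the coefficient of $t^d$ in $\eta_m(t)$ is the number of finite multisets of (nonempty) $m$-colored necklaces with $d$ beads in total. 3. For every choice of the integers $n(\lambda,\boldsymbol\mu)$ as above, $$\eta_m(t) = \sum_{\lambda,\,\boldsymbol\mu} \left(c^\lambda_{\boldsymbol\mu}\right)^2 t^{|\lambda|},$$ a convergent sum of formal power series over all partitions $\lambda$ and all $m$-tuples of partitions $\boldsymbol\mu$. -/

import Mathlib

open scoped TensorProduct PowerSeries PowerSeries.WithPiTopology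

noncomputable section

namespace LRSquares

/-! Integer partitions are represented by Mathlib's Young diagrams `lam : YoungDiagram`; the size
`|lam|` is `lam.card`, the length (number of nonzero parts) is `lam.colLen 0`, and a cell is a pair
`(row, column)`, both counted from `0`. -/

/-- The diagonal action of `G` on the tensor product of a family of representations. -/
def piTensor {k G ι : Type*} [CommSemiring k] [Monoid G] {V : ι → Type*}
    [∀ i, AddCommMonoid (V i)] [∀ i, Module k (V i)] (ρ : ∀ i, Representation k G (V i)) :
    Representation k G (⨂[k] i, V i) where
  toFun g := PiTensorProduct.map fun i => ρ i g
  map_one' := by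
    simp only [map_one]
    exact PiTensorProduct.map_one
  map_mul' g h := by
    simp only [map_mul]
    exact PiTensorProduct.map_mul _ _

/-- The standard representation of `GL_n(ℂ)` on `ℂ^n`. -/
def stdRep (n : ℕ) : Representation ℂ (GL (Fin n) ℂ) (Fin n → ℂ) where
  toFun g := Matrix.mulVecLin (g : Matrix (Fin n) (Fin n) ℂ)
  map_one' := by simp [Module.End.one_eq_id]
  map_mul' g h := by simp [Matrix.mulVecLin_mul, Module.End.mul_eq_comp]

/-- `GL_n(ℂ)` acting diagonally on the tensor power of `ℂ^n` whose factors are indexed by the cells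
of `lam`. -/
def tensorRep (n : ℕ) (lam : YoungDiagram) :
    Representation ℂ (GL (Fin n) ℂ) (⨂[ℂ] _c : lam.cells, (Fin n → ℂ)) :=
  piTensor fun _ => stdRep n

/-- The standard basis vector `e_i` of `ℂ^n`, for `i < n` (and `0` for `i ≥ n`). -/
def stdVec (n i : ℕ) : Fin n → ℂ := fun k => if (k : ℕ) = i then 1 else 0

/-- The permutations of the cells of `lam` that preserve every column. -/
def columnPerms (lam : YoungDiagram) : Finset (Equiv.Perm lam.cells) :=
  Finset.univ.filter fun q => ∀ c, (q c : ℕ × ℕ).2 = (c : ℕ × ℕ).2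

/-- The tensor that puts `e_i` in the cells of row `i`, antisymmetrized along every column: up to
the identification of the tensor factors it is the product over the columns `j` of
`e_0 ∧ e_1 ∧ ⋯ ∧ e_{lam'_j - 1}`. When `n` is at least the length of `lam`, it is nonzero, fixed by
the upper unitriangular matrices, and `diag(t_0, …, t_{n-1})` multiplies it by
`∏ i, t_i ^ (lam.rowLen i)`: it is a highest weight vector of weight `lam`. -/
def highestWeightVec (n : ℕ) (lam : YoungDiagram) : ⨂[ℂ] _c : lam.cells, (Fin n → ℂ) :=
  ∑ q ∈ columnPerms lam, ((Equiv.Perm.sign q : ℤ) : ℂ) •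
    PiTensorProduct.tprod ℂ fun c => stdVec n (q c : ℕ × ℕ).1

/-- The `GL_n(ℂ)`-submodule of the tensor power generated by the highest weight vector. -/
def irrepSubmodule (n : ℕ) (lam : YoungDiagram) :
    Submodule ℂ (⨂[ℂ] _c : lam.cells, (Fin n → ℂ)) :=
  Submodule.span ℂ (Set.range fun g => tensorRep n lam g (highestWeightVec n lam))

theorem irrepSubmodule_le_comap (n : ℕ) (lam : YoungDiagram) (g : GL (Fin n) ℂ) :
    irrepSubmodule n lam ≤ (irrepSubmodule n lam).comap (tensorRep n lam g) := by
  refine Submodule.span_le.2 ?_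
  rintro _ ⟨h, rfl⟩
  refine Submodule.subset_span ⟨g * h, ?_⟩
  simp only [map_mul]
  rfl

/-- The finite-dimensional irreducible polynomial representation of `GL_n(ℂ)` with highest weight
`lam`, for `n` at least the length of `lam`: the cyclic submodule of the (completely reducible)
tensor power generated by a highest weight vector of weight `lam`. -/
def irrep (n : ℕ) (lam : YoungDiagram) :
    Representation ℂ (GL (Fin n) ℂ) (irrepSubmodule n lam) :=
  (tensorRep n lam).subrepresentation (irrepSubmodule n lam) (irrepSubmodule_le_comap n lam)

/-- The multiplicity of the irreducible representation with highest weight `lam` in the tensor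
product of the irreducible representations with highest weights `mu 0, …, mu (m - 1)`, under the
diagonal action of `GL_n(ℂ)`: the dimension of the space of equivariant maps. -/
def lrCoeff (n : ℕ) {m : ℕ} (lam : YoungDiagram) (mu : Fin m → YoungDiagram) : ℕ :=
  Module.finrank ℂ
    (Representation.IntertwiningMap (irrep n lam) (piTensor fun j => irrep n (mu j)))

/-- `N_k(m) = (1/k) ∑_{r ∣ k} φ(r) m^(k/r)`. -/
def necklaceCount (k m : ℕ) : ℕ :=
  (∑ r ∈ k.divisors, r.totient * m ^ (k / r)) / k

/-- The factor `(1 - t^k)^(-N_k(m))`, as a formal power series. -/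
def etaFactor (m k : ℕ) : ℤ⟦X⟧ :=
  (PowerSeries.invOfUnit (1 - PowerSeries.X ^ k) 1) ^ necklaceCount k m

/-- `η_m(t) = ∏_{k ≥ 1} (1 - t^k)^(-N_k(m))`, an infinite product of formal power series. -/
def eta (m : ℕ) : ℤ⟦X⟧ := ∏' k : ℕ, etaFactor m (k + 1)

end LRSquares

end

set_option linter.unusedSectionVars false

noncomputable section

namespace LRSquares

/-! ### The linear category of bijections -/

section Bijections

variable {S T U W : Type*} [Fintype S] [DecidableEq S] [Fintype T] [DecidableEq T]
  [Fintype U] [DecidableEq U] [Fintype W] [DecidableEq W]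

/-! Both sides have the same coefficient of t^d, namely ∑ m^ℓ(p) over the partitions p of d.

Product side: the logarithmic derivative (for t d/dt) of `eta m` has coefficients ∑_{k∣j} k N_k(m),
that of ∏ 1/(1 - m t^k) has coefficients ∑_{k∣j} k m^(j/k). They agree because k N_k(m) is the
Dirichlet convolution of φ with k ↦ m^k and 1 * φ = id (`sum_divisors_necklaceCount`). The second
product enumerates partitions with weight m^ℓ(p) (`coeff_eta`). Burnside's lemma counts necklaces
(`card_orbits_mul`), and expanding one geometric series per necklace counts multisets
(`coeff_eta_eq_card`).

Sum side: let e_λ be the Young idempotent and e_μ the external product of the idempotents of the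
entries of μ. Schur–Weyl duality identifies the equivariant maps with e_μ B e_λ, where B is spanned
by the bijections from the cells of λ to those of μ (`toIntertwining_bijective`). The dimension is
the trace of z ↦ e_μ z e_λ, that is (1/d!) ∑_g χ_λ(g) χ_μ(g⁻¹) with χ_μ an induced character. Let
z(g,h) be the number of x with x g = h x. Column orthogonality gives ∑_λ χ_λ(g) χ_λ(h⁻¹) = z(g,h)
(`sum_youngIdem_chr_mul_chr`), and applied color by color ∑_μ χ_μ(g) χ_μ(h⁻¹) = m^cyc(g) z(g,h)
(`sum_chr_tupleIdem_mul_chr`). The sum of squares becomes (1/d!) ∑_h m^cyc(h) z(h,h), which is one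
term m^ℓ(p) per conjugacy class (`sum_traceMult_sq`).

Working with bijections between arbitrary finite sets avoids numbering the cells of diagrams. -/

/-- Precomposition with a bijection. -/
def transLeft (σ : S ≃ T) : (T ≃ U) ≃ (S ≃ U) where
  toFun τ := σ.trans τ
  invFun ρ := σ.symm.trans ρ
  left_inv τ := by ext; simp
  right_inv ρ := by ext; simp

/-- Postcomposition with a bijection. -/
def transRight (τ : T ≃ U) : (S ≃ T) ≃ (S ≃ U) where
  toFun σ := σ.trans τ
  invFun ρ := ρ.trans τ.symm
  left_inv σ := by ext; simp
  right_inv ρ := by ext; simp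

/-- Composition in the linearization of the groupoid of finite sets and bijections:
`conv y z` applies `z` first. -/
def conv : ((T ≃ U) → ℂ) →ₗ[ℂ] ((S ≃ T) → ℂ) →ₗ[ℂ] ((S ≃ U) → ℂ) :=
  LinearMap.mk₂ ℂ (fun y z υ => ∑ σ : S ≃ T, z σ * y (σ.symm.trans υ))
    (fun y y' z => by ext; simp [mul_add, Finset.sum_add_distrib])
    (fun a y z => by
      ext; simp only [Pi.smul_apply, smul_eq_mul, Finset.mul_sum]
      exact Finset.sum_congr rfl fun _ _ => by ring)
    (fun y z z' => by ext; simp [add_mul, Finset.sum_add_distrib])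
    (fun a y z => by ext; simp [Finset.mul_sum, mul_assoc])

theorem conv_apply (y : (T ≃ U) → ℂ) (z : (S ≃ T) → ℂ) (υ : S ≃ U) :
    conv y z υ = ∑ σ : S ≃ T, z σ * y (σ.symm.trans υ) := rfl

theorem conv_assoc (x : (U ≃ W) → ℂ) (y : (T ≃ U) → ℂ) (z : (S ≃ T) → ℂ) :
    conv (conv x y) z = conv x (conv y z) := by
  ext υ
  simp only [conv_apply, Finset.mul_sum, Finset.sum_mul]
  conv_rhs => rw [Finset.sum_comm]
  refine Finset.sum_congr rfl fun σ _ => ?_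
  refine Fintype.sum_equiv (transLeft σ) _ _ fun τ => ?_
  have h1 : σ.symm.trans (transLeft σ τ) = τ := by
    ext; simp [transLeft]
  have h2 : (transLeft σ τ).symm.trans υ = τ.symm.trans (σ.symm.trans υ) := by
    ext; simp [transLeft]
  rw [h1, h2, mul_assoc]

/-- The basis element given by a bijection. -/
def delta (σ : S ≃ T) : (S ≃ T) → ℂ := fun τ => if τ = σ then 1 else 0

theorem delta_self (σ : S ≃ T) : delta σ σ = 1 := if_pos rfl

theorem delta_of_ne {σ τ : S ≃ T} (h : τ ≠ σ) : delta σ τ = 0 := if_neg h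

theorem sum_smul_delta (y : (S ≃ T) → ℂ) : y = ∑ σ, y σ • delta σ := by
  ext τ
  simp [Finset.sum_apply, delta]

theorem conv_delta_left (τ : T ≃ U) (z : (S ≃ T) → ℂ) (υ : S ≃ U) :
    conv (delta τ) z υ = z (υ.trans τ.symm) := by
  rw [conv_apply, Finset.sum_eq_single (υ.trans τ.symm)]
  · have : (υ.trans τ.symm).symm.trans υ = τ := by ext; simp
    rw [this, delta_self, mul_one]
  · intro σ _ h
    rw [delta_of_ne, mul_zero]
    rintro rfl
    exact h (by ext; simp)
  · simp

theorem conv_delta_right (y : (T ≃ U) → ℂ) (σ : S ≃ T) (υ : S ≃ U) :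
    conv y (delta σ) υ = y (σ.symm.trans υ) := by
  rw [conv_apply, Finset.sum_eq_single σ]
  · rw [delta_self, one_mul]
  · intro σ' _ h
    rw [delta_of_ne h, zero_mul]
  · simp

theorem conv_delta_delta (τ : T ≃ U) (σ : S ≃ T) :
    conv (delta τ) (delta σ) = delta (σ.trans τ) := by
  ext υ
  rw [conv_delta_right]
  unfold delta
  congr 1
  simp only [eq_iff_iff]
  constructor
  · rintro rfl; ext; simp
  · rintro rfl; ext; simp

theorem conv_eq_sum_left (y : (T ≃ U) → ℂ) (z : (S ≃ T) → ℂ) :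
    conv y z = ∑ τ, y τ • conv (delta τ) z := by
  conv_lhs => rw [sum_smul_delta y]
  simp [LinearMap.sum_apply]

theorem conv_eq_sum_right (y : (T ≃ U) → ℂ) (z : (S ≃ T) → ℂ) :
    conv y z = ∑ σ, z σ • conv y (delta σ) := by
  conv_lhs => rw [sum_smul_delta z]
  simp

/-- The conjugate transpose. -/
def adj (y : (S ≃ T) → ℂ) : (T ≃ S) → ℂ := fun τ => star (y τ.symm)

theorem adj_conv (y : (T ≃ U) → ℂ) (z : (S ≃ T) → ℂ) : adj (conv y z) = conv (adj z) (adj y) := by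
  ext υ
  simp only [adj, conv_apply, star_sum, star_mul']
  refine Fintype.sum_equiv (transLeft υ) _ _ fun σ => ?_
  rw [mul_comm]
  congr 3
  ext; simp [transLeft]

theorem adj_adj (y : (S ≃ T) → ℂ) : adj (adj y) = y := by
  ext; simp [adj]

theorem adj_zero : adj (0 : (S ≃ T) → ℂ) = 0 := by
  ext; simp [adj]

/-- The coefficient of y* y at the identity is ∑ |y σ|². This positivity replaces semisimplicity
arguments below. -/
theorem eq_zero_of_conv_adj_self {y : (S ≃ T) → ℂ} (h : conv (adj y) y = 0) : y = 0 := by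
  have h1 := congrFun h (Equiv.refl S)
  simp only [conv_apply, adj, Pi.zero_apply] at h1
  have h2 : ∑ σ : S ≃ T, (Complex.normSq (y σ) : ℂ) = 0 := by
    rw [← h1]
    refine Finset.sum_congr rfl fun σ _ => ?_
    rw [← Complex.mul_conj]; rfl
  have h3 : ∑ σ : S ≃ T, Complex.normSq (y σ) = 0 := by exact_mod_cast h2
  rw [Finset.sum_eq_zero_iff_of_nonneg fun _ _ => Complex.normSq_nonneg _] at h3
  ext σ
  exact Complex.normSq_eq_zero.1 (h3 σ (Finset.mem_univ _))

/-- The sum of the permutations that preserve a labelling. -/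
def symmetrizer {α : Type*} [DecidableEq α] (r : S → α) : (S ≃ S) → ℂ :=
  fun p => if ∀ c, r (p c) = r c then 1 else 0

/-- The signed sum of the permutations that preserve a labelling. -/
def antisymmetrizer {α : Type*} [DecidableEq α] (k : S → α) : (S ≃ S) → ℂ :=
  fun q => if ∀ c, k (q c) = k c then ((Equiv.Perm.sign q : ℤ) : ℂ) else 0

section Labels

variable {α : Type*} [DecidableEq α] (r : S → α)

theorem preserves_trans_iff {p q : S ≃ S} (hp : ∀ c, r (p c) = r c) :
    (∀ c, r ((p.trans q) c) = r c) ↔ ∀ c, r (q c) = r c := by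
  refine ⟨fun h c => ?_, fun h c => ?_⟩
  · rw [← p.apply_symm_apply c]
    exact (h _).trans (hp _).symm
  · exact (h _).trans (hp _)

theorem preserves_symm {p : S ≃ S} (hp : ∀ c, r (p c) = r c) (c : S) : r (p.symm c) = r c := by
  rw [← hp, p.apply_symm_apply]

theorem symmetrizer_symm (p : S ≃ S) : symmetrizer r p.symm = symmetrizer r p := by
  unfold symmetrizer
  congr 1
  exact propext ⟨fun h => preserves_symm r h, fun h => preserves_symm r h⟩

theorem antisymmetrizer_symm (p : S ≃ S) : antisymmetrizer r p.symm = antisymmetrizer r p := by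
  unfold antisymmetrizer
  rw [Equiv.Perm.sign_symm]
  congr 1
  exact propext ⟨fun h => preserves_symm r h, fun h => preserves_symm r h⟩

theorem adj_symmetrizer : adj (symmetrizer r) = symmetrizer r := by
  ext p
  rw [adj, symmetrizer_symm]
  unfold symmetrizer
  split_ifs <;> simp

theorem adj_antisymmetrizer : adj (antisymmetrizer r) = antisymmetrizer r := by
  ext p
  rw [adj, antisymmetrizer_symm]
  unfold antisymmetrizer
  split_ifs <;> simp

theorem delta_conv_symmetrizer {p : S ≃ S} (hp : ∀ c, r (p c) = r c) :
    conv (delta p) (symmetrizer r) = symmetrizer r := by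
  ext υ
  rw [conv_delta_left, ← symmetrizer_symm, ← symmetrizer_symm r υ]
  unfold symmetrizer
  congr 1
  exact propext (preserves_trans_iff r (q := υ.symm) hp)

theorem antisymmetrizer_conv_delta {q : S ≃ S} (hq : ∀ c, r (q c) = r c) :
    conv (antisymmetrizer r) (delta q) = ((Equiv.Perm.sign q : ℤ) : ℂ) • antisymmetrizer r := by
  ext υ
  rw [conv_delta_right, Pi.smul_apply]
  unfold antisymmetrizer
  simp only [preserves_trans_iff r (preserves_symm r hq), smul_ite, smul_zero]
  rw [Equiv.Perm.sign_trans, Equiv.Perm.sign_symm]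
  simp [mul_comm]

/-- The number of permutations that preserve a labelling. -/
def labelCard : ℕ := (Finset.univ.filter fun p : S ≃ S => ∀ c, r (p c) = r c).card

theorem labelCard_ne_zero : (labelCard r : ℂ) ≠ 0 := by
  rw [Nat.cast_ne_zero, labelCard, Finset.card_ne_zero]
  exact ⟨Equiv.refl S, by simp⟩

theorem symmetrizer_conv_symmetrizer :
    conv (symmetrizer r) (symmetrizer r) = (labelCard r : ℂ) • symmetrizer r := by
  rw [conv_eq_sum_left, labelCard, Finset.cast_card, Finset.sum_smul, Finset.sum_filter]
  refine Finset.sum_congr rfl fun p _ => ?_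
  unfold symmetrizer
  split_ifs with h
  · exact congrArg _ (delta_conv_symmetrizer r h)
  · exact zero_smul _ _

theorem antisymmetrizer_conv_antisymmetrizer :
    conv (antisymmetrizer r) (antisymmetrizer r) = (labelCard r : ℂ) • antisymmetrizer r := by
  rw [conv_eq_sum_right, labelCard, Finset.cast_card, Finset.sum_smul, Finset.sum_filter]
  refine Finset.sum_congr rfl fun q _ => ?_
  by_cases h : ∀ c, r (q c) = r c
  · rw [antisymmetrizer_conv_delta r h, if_pos h, smul_smul, antisymmetrizer, if_pos h]
    congr 1
    rw [← Int.cast_mul, ← Units.val_mul, Int.units_mul_self]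
    simp
  · rw [if_neg h, antisymmetrizer, if_neg h, zero_smul]

end Labels

/-- The symmetrizer absorbs the transposition of u and v. Moved across x it becomes the
transposition of x u and x v, which the antisymmetrizer absorbs with sign -1, so the product equals
its own negative. -/
theorem antisymmetrizer_conv_delta_conv_symmetrizer_eq_zero {α β : Type*} [DecidableEq α]
    [DecidableEq β] (k : T → α) (r : S → β) (x : S ≃ T) {u v : S} (huv : u ≠ v) (hr : r u = r v)
    (hk : k (x u) = k (x v)) :
    conv (antisymmetrizer k) (conv (delta x) (symmetrizer r)) = 0 := by
  have h1 : ∀ c, r (Equiv.swap u v c) = r c := by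
    intro c
    rw [Equiv.swap_apply_def]
    split_ifs with h h' <;> simp_all
  have h2 : ∀ c, k (Equiv.swap (x u) (x v) c) = k c := by
    intro c
    rw [Equiv.swap_apply_def]
    split_ifs with h h' <;> simp_all
  have h3 : (Equiv.swap u v).trans x = x.trans (Equiv.swap (x u) (x v)) := by
    ext c
    simp [Equiv.swap_apply_def]
    split_ifs <;> simp_all
  have h4 : conv (antisymmetrizer k) (conv (delta x) (symmetrizer r))
      = -conv (antisymmetrizer k) (conv (delta x) (symmetrizer r)) := by
    conv_lhs =>
      rw [← delta_conv_symmetrizer r h1, ← conv_assoc (delta x), conv_delta_delta, h3,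
        ← conv_delta_delta, conv_assoc, ← conv_assoc, antisymmetrizer_conv_delta k h2,
        Equiv.Perm.sign_swap (x.injective.ne huv)]
    simp
  exact self_eq_neg.1 h4

end Bijections

/-! ### Young symmetrizers -/

section Young

variable {lam mu : YoungDiagram}

/-- The row of a cell. -/
def rowOf (lam : YoungDiagram) (c : lam.cells) : ℕ := (c : ℕ × ℕ).1

/-- The column of a cell. -/
def colOf (lam : YoungDiagram) (c : lam.cells) : ℕ := (c : ℕ × ℕ).2

theorem cell_ext {u v : lam.cells} (h : rowOf lam u = rowOf lam v) (h' : colOf lam u = colOf lam v) :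
    u = v := Subtype.ext (Prod.ext h h')

theorem colOf_lt_rowLen (u : lam.cells) : colOf lam u < lam.rowLen (rowOf lam u) :=
  YoungDiagram.mem_iff_lt_rowLen.1 u.2

/-- The number of cells in the first `k` columns. -/
def colSum (lam : YoungDiagram) (k : ℕ) : ℕ :=
  (Finset.univ.filter fun c : lam.cells => colOf lam c < k).card

theorem colSum_succ (lam : YoungDiagram) (k : ℕ) :
    colSum lam (k + 1) = colSum lam k + lam.colLen k := by
  have h1 : lam.colLen k = (Finset.univ.filter fun c : lam.cells => colOf lam c = k).card := by
    rw [YoungDiagram.colLen_eq_card, ← Fintype.card_subtype, ← Fintype.card_coe]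
    refine Fintype.card_congr ⟨fun c => ⟨⟨c.1, ?_⟩, ?_⟩, fun c => ⟨c.1.1, ?_⟩, ?_, ?_⟩
    · exact (YoungDiagram.mem_col_iff.1 c.2).1
    · exact (YoungDiagram.mem_col_iff.1 c.2).2
    · exact YoungDiagram.mem_col_iff.2 ⟨c.1.2, c.2⟩
    · intro c; rfl
    · intro c; rfl
  rw [h1, colSum, colSum, ← Finset.card_union_of_disjoint, ← Finset.filter_or]
  · congr 1
    ext c
    simp only [Finset.mem_filter, Finset.mem_univ, true_and]
    omega
  · rw [Finset.disjoint_filter]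
    intro c _ h; omega

theorem eq_of_colSum_eq (h : ∀ k, colSum lam k = colSum mu k) : lam = mu := by
  have h1 : ∀ k, lam.colLen k = mu.colLen k := fun k => by
    have := h (k + 1)
    rw [colSum_succ, colSum_succ, h k] at this
    omega
  refine YoungDiagram.ext ?_
  ext ⟨i, j⟩
  rw [YoungDiagram.mem_cells, YoungDiagram.mem_cells, YoungDiagram.mem_iff_lt_colLen,
    YoungDiagram.mem_iff_lt_colLen, h1]

/-- The bijection sends distinct cells of a row to distinct columns. -/
def RowsToColumns (x : lam.cells ≃ mu.cells) : Prop :=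
  ∀ u v, u ≠ v → rowOf lam u = rowOf lam v → colOf mu (x u) ≠ colOf mu (x v)

theorem card_row_filter_lt (i k : ℕ) :
    (Finset.univ.filter fun u : lam.cells => rowOf lam u = i ∧ colOf lam u < k).card
      = min k (lam.rowLen i) := by
  rw [← Finset.card_range (min k (lam.rowLen i)), ← Fintype.card_subtype, ← Fintype.card_coe]
  refine Fintype.card_congr ⟨fun c => ⟨colOf lam c.1, ?_⟩, fun j => ⟨⟨(i, j.1), ?_⟩, ?_⟩, ?_, ?_⟩
  · have h1 := colOf_lt_rowLen c.1
    rw [c.2.1] at h1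
    exact Finset.mem_range.2 (lt_min c.2.2 h1)
  · have := Finset.mem_range.1 j.2
    exact YoungDiagram.mem_iff_lt_rowLen.2 (lt_of_lt_of_le this (min_le_right _ _))
  · have := Finset.mem_range.1 j.2
    exact ⟨rfl, lt_of_lt_of_le this (min_le_left _ _)⟩
  · intro c
    exact Subtype.ext (cell_ext c.2.1.symm rfl)
  · intro j; rfl

/-- The cells of row i land in distinct columns, so at most min k (row length) of them land in the
first k columns; the left-justified row attains this bound. -/
theorem RowsToColumns.card_le {x : lam.cells ≃ mu.cells} (hx : RowsToColumns x) (i k : ℕ) :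
    (Finset.univ.filter fun u : lam.cells => rowOf lam u = i ∧ colOf mu (x u) < k).card
      ≤ (Finset.univ.filter fun u : lam.cells => rowOf lam u = i ∧ colOf lam u < k).card := by
  rw [card_row_filter_lt]
  refine le_min ?_ ?_
  · rw [← Finset.card_range k]
    refine Finset.card_le_card_of_injOn (fun u => colOf mu (x u)) ?_ ?_
    · intro u hu
      simp only [Finset.coe_filter, Finset.mem_univ, true_and, Set.mem_ofPred_eq] at hu
      simpa using hu.2
    · intro u hu v hv huv
      simp only [Finset.coe_filter, Finset.mem_univ, true_and, Set.mem_ofPred_eq] at hu hv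
      by_contra h
      exact hx u v h (hu.1.trans hv.1.symm) huv
  · rw [← min_self (lam.rowLen i), ← card_row_filter_lt]
    refine Finset.card_le_card fun u hu => ?_
    simp only [Finset.mem_filter, Finset.mem_univ, true_and] at hu ⊢
    refine ⟨hu.1, ?_⟩
    rw [← hu.1]
    exact colOf_lt_rowLen u

theorem card_filter_eq_sum_rows (P : lam.cells → Prop) [DecidablePred P] :
    (Finset.univ.filter P).card = ∑ i ∈ Finset.univ.image (rowOf lam),
      (Finset.univ.filter fun u : lam.cells => rowOf lam u = i ∧ P u).card := by
  rw [Finset.card_eq_sum_card_fiberwise (f := rowOf lam)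
    (t := Finset.univ.image (rowOf lam)) (fun u _ => by simp)]
  refine Finset.sum_congr rfl fun i _ => ?_
  congr 1
  ext u
  simp [and_comm]

theorem colSum_eq_of_equiv (x : lam.cells ≃ mu.cells) (k : ℕ) :
    colSum mu k = (Finset.univ.filter fun u : lam.cells => colOf mu (x u) < k).card := by
  rw [colSum, ← Fintype.card_subtype, ← Fintype.card_subtype]
  exact (Fintype.card_congr (x.subtypeEquiv fun _ => Iff.rfl)).symm

/-- This is the dominance order on conjugate partitions; its antisymmetry separates distinct shapes.
-/
theorem RowsToColumns.colSum_le {x : lam.cells ≃ mu.cells} (hx : RowsToColumns x) (k : ℕ) :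
    colSum mu k ≤ colSum lam k := by
  rw [colSum_eq_of_equiv x, colSum, card_filter_eq_sum_rows, card_filter_eq_sum_rows]
  exact Finset.sum_le_sum fun i _ => hx.card_le i k

/-- For equal shapes the row inequalities have equal totals, so each is an equality. With k the
length of the row of u, the whole row must land in the first k columns. -/
theorem RowsToColumns.colOf_lt {x : lam.cells ≃ lam.cells} (hx : RowsToColumns x) (u : lam.cells) :
    colOf lam (x u) < lam.rowLen (rowOf lam u) := by
  set k := lam.rowLen (rowOf lam u) with hk
  have h1 : colSum lam k = colSum lam k := rfl
  conv_lhs at h1 => rw [colSum_eq_of_equiv x]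
  rw [colSum, card_filter_eq_sum_rows, card_filter_eq_sum_rows,
    Finset.sum_eq_sum_iff_of_le fun i _ => hx.card_le i k] at h1
  by_contra h3
  have h4 : (Finset.univ.filter fun v : lam.cells =>
      rowOf lam v = rowOf lam u ∧ colOf lam (x v) < k).card
      < (Finset.univ.filter fun v : lam.cells =>
      rowOf lam v = rowOf lam u ∧ colOf lam v < k).card := by
    refine Finset.card_lt_card ⟨fun v hv => ?_, fun hs => h3 ?_⟩
    · simp only [Finset.mem_filter, Finset.mem_univ, true_and] at hv ⊢
      refine ⟨hv.1, ?_⟩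
      rw [hk, ← hv.1]
      exact colOf_lt_rowLen v
    · have h5 := @hs u (Finset.mem_filter.2 ⟨Finset.mem_univ _, rfl, colOf_lt_rowLen u⟩)
      exact (Finset.mem_filter.1 h5).2.2
  exact absurd (h1 (rowOf lam u) (Finset.mem_image_of_mem _ (Finset.mem_univ u))) h4.ne

/-- A bijection that sends distinct cells of a row to distinct columns is a row-preserving
permutation followed by a column-preserving one. -/
theorem RowsToColumns.exists_factorization {x : lam.cells ≃ lam.cells} (hx : RowsToColumns x) :
    ∃ p q : lam.cells ≃ lam.cells, (∀ c, rowOf lam (p c) = rowOf lam c) ∧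
      (∀ c, colOf lam (q c) = colOf lam c) ∧ p.trans q = x := by
  -- Slide each cell along its row to the column that x gives it. This is the row permutation p, and
  -- what remains of x preserves columns.
  let f : lam.cells → lam.cells := fun u => ⟨(rowOf lam u, colOf lam (x u)),
    YoungDiagram.mem_iff_lt_rowLen.2 (hx.colOf_lt u)⟩
  have hf : Function.Injective f := by
    intro u v huv
    have h1 : rowOf lam u = rowOf lam v := by
      have := congrArg (rowOf lam) huv
      exact this
    have h2 : colOf lam (x u) = colOf lam (x v) := by
      have := congrArg (colOf lam) huv
      exact this
    by_contra h
    exact hx u v h h1 h2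
  let p : lam.cells ≃ lam.cells := Equiv.ofBijective f (Finite.injective_iff_bijective.1 hf)
  refine ⟨p, p.symm.trans x, fun c => rfl, fun c => ?_, Equiv.ext fun c => ?_⟩
  · obtain ⟨u, rfl⟩ := p.surjective c
    simp only [Equiv.trans_apply, Equiv.symm_apply_apply]
    rfl
  · simp only [Equiv.trans_apply, Equiv.symm_apply_apply]

variable (lam) in
/-- The Young symmetrizer, not normalized. -/
def youngSym : (lam.cells ≃ lam.cells) → ℂ :=
  conv (antisymmetrizer (colOf lam)) (symmetrizer (rowOf lam))

theorem conv_delta_of_not_rowsToColumns {x : lam.cells ≃ mu.cells} (hx : ¬RowsToColumns x) :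
    conv (antisymmetrizer (colOf mu)) (conv (delta x) (symmetrizer (rowOf lam))) = 0 := by
  unfold RowsToColumns at hx
  push Not at hx
  obtain ⟨u, v, huv, hr, hc⟩ := hx
  exact antisymmetrizer_conv_delta_conv_symmetrizer_eq_zero _ _ x huv hr hc

theorem conv_conv_eq_zero_of_forall (h : ∀ x : lam.cells ≃ mu.cells, ¬RowsToColumns x)
    (y : (lam.cells ≃ mu.cells) → ℂ) :
    conv (antisymmetrizer (colOf mu)) (conv y (symmetrizer (rowOf lam))) = 0 := by
  rw [conv_eq_sum_left y, map_sum]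
  refine Finset.sum_eq_zero fun x _ => ?_
  rw [map_smul, conv_delta_of_not_rowsToColumns (h x), smul_zero]

/-- With column antisymmetrizer b and row symmetrizer a, the product is b_μ a_μ y b_λ a_λ. By
dominance, `RowsToColumns` bijections cannot exist in both directions. If there is none from λ to μ,
then b_μ (⋯) a_λ = 0; if none from μ to λ, then b_λ y* a_μ = 0, whose adjoint is the inner factor
a_μ y b_λ. -/
theorem youngSym_conv_youngSym_of_ne (h : lam ≠ mu) (y : (lam.cells ≃ mu.cells) → ℂ) :
    conv (youngSym mu) (conv y (youngSym lam)) = 0 := by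
  by_cases h1 : ∀ x : lam.cells ≃ mu.cells, ¬RowsToColumns x
  · have h2 := conv_conv_eq_zero_of_forall h1
      (conv (symmetrizer (rowOf mu)) (conv y (antisymmetrizer (colOf lam))))
    rw [youngSym, youngSym, conv_assoc, ← conv_assoc y, ← conv_assoc (symmetrizer (rowOf mu)), h2]
  · have h1' : ∀ x : mu.cells ≃ lam.cells, ¬RowsToColumns x := by
      intro x hx
      push Not at h1
      obtain ⟨x', hx'⟩ := h1
      exact h (eq_of_colSum_eq fun k => le_antisymm (hx.colSum_le k) (hx'.colSum_le k))
    have h2 := conv_conv_eq_zero_of_forall h1' (adj y)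
    have h3 := congrArg adj h2
    rw [adj_conv, adj_conv, adj_adj, adj_symmetrizer, adj_antisymmetrizer, adj_zero,
      conv_assoc] at h3
    rw [youngSym, youngSym, conv_assoc, ← conv_assoc y, ← conv_assoc (symmetrizer (rowOf mu)), h3]
    simp

/-- Von Neumann's lemma: a bijection contributes only if it factors as a row permutation followed by
a column permutation q, and then it contributes sign q. -/
theorem exists_smul_youngSym (y : (lam.cells ≃ lam.cells) → ℂ) :
    ∃ t : ℂ, conv (antisymmetrizer (colOf lam)) (conv y (symmetrizer (rowOf lam)))
      = t • youngSym lam := by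
  have h1 : ∀ x : lam.cells ≃ lam.cells, ∃ t : ℂ,
      conv (antisymmetrizer (colOf lam)) (conv (delta x) (symmetrizer (rowOf lam)))
        = t • youngSym lam := by
    intro x
    by_cases hx : RowsToColumns x
    · obtain ⟨p, q, hp, hq, rfl⟩ := hx.exists_factorization
      refine ⟨((Equiv.Perm.sign q : ℤ) : ℂ), ?_⟩
      rw [← conv_delta_delta, conv_assoc, delta_conv_symmetrizer _ hp, ← conv_assoc,
        antisymmetrizer_conv_delta _ hq, map_smul, LinearMap.smul_apply, youngSym]
    · exact ⟨0, by rw [conv_delta_of_not_rowsToColumns hx, zero_smul]⟩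
  choose t ht using h1
  refine ⟨∑ x, y x * t x, ?_⟩
  rw [conv_eq_sum_left y, map_sum, Finset.sum_smul]
  refine Finset.sum_congr rfl fun x _ => ?_
  rw [map_smul, ht, smul_smul]

/-- The coefficient at the identity is 1, as only the identity preserves both rows and columns. -/
theorem youngSym_ne_zero : youngSym lam ≠ 0 := by
  intro h
  have h1 := congrFun h (Equiv.refl _)
  rw [youngSym, conv_apply, Finset.sum_eq_single (Equiv.refl _)] at h1
  · simp [symmetrizer, antisymmetrizer] at h1
  · intro p _ hp
    by_cases hr : ∀ c, rowOf lam (p c) = rowOf lam c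
    · by_cases hc : ∀ c, colOf lam (p c) = colOf lam c
      · exact absurd (Equiv.ext fun c => cell_ext (hr c) (hc c)) hp
      · have : p.symm.trans (Equiv.refl _) = p.symm := rfl
        rw [this, antisymmetrizer_symm, antisymmetrizer, if_neg hc, mul_zero]
    · rw [symmetrizer, if_neg hr, zero_mul]
  · simp

/-- Von Neumann's lemma gives the scalar. It is nonzero by positivity, without a hook length
formula: if (ba)(ba) = 0, then the self-adjoint bab has square a multiple of (ba)(ba)b = 0, so bab =
0; then (ab)*(ab) is a multiple of bab, so ab = 0 and ba = (ab)* = 0. -/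
theorem exists_youngSym_conv_self :
    ∃ t : ℂ, t ≠ 0 ∧ conv (youngSym lam) (youngSym lam) = t • youngSym lam := by
  set a := symmetrizer (rowOf lam) with ha
  set b := antisymmetrizer (colOf lam) with hb
  obtain ⟨t, ht⟩ := exists_smul_youngSym (conv a b)
  have h1 : conv (youngSym lam) (youngSym lam) = t • youngSym lam := by
    rw [← ht, youngSym, conv_assoc, conv_assoc]
  refine ⟨t, ?_, h1⟩
  rintro rfl
  rw [zero_smul] at h1
  have h2 : conv (adj (conv a b)) (conv a b) = (labelCard (rowOf lam) : ℂ) • conv b (conv a b) := by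
    rw [adj_conv, ha, hb, adj_symmetrizer, adj_antisymmetrizer, conv_assoc, ← conv_assoc _ _ (antisymmetrizer _),
      symmetrizer_conv_symmetrizer]
    simp
  have h3 : adj (conv b (conv a b)) = conv b (conv a b) := by
    rw [adj_conv, adj_conv, ha, hb, adj_symmetrizer, adj_antisymmetrizer, conv_assoc]
  have h4 : conv b (conv a b) = 0 := by
    apply eq_zero_of_conv_adj_self
    rw [h3, conv_assoc, conv_assoc, ← conv_assoc b b, hb, antisymmetrizer_conv_antisymmetrizer,
      ← hb, map_smul, LinearMap.smul_apply, map_smul, map_smul]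
    have h5 : conv b (conv a (conv b (conv a b))) = conv (conv (youngSym lam) (youngSym lam)) b := by
      rw [youngSym, ← ha, ← hb, conv_assoc, conv_assoc, conv_assoc]
    rw [h5, h1]
    simp
  rw [h4, smul_zero] at h2
  have h6 := eq_zero_of_conv_adj_self h2
  apply youngSym_ne_zero (lam := lam)
  rw [youngSym, ← ha, ← hb, ← adj_adj (conv b a), adj_conv, ha, hb, adj_symmetrizer,
    adj_antisymmetrizer, ← ha, ← hb, h6, adj_zero]

variable (lam) in
/-- The scalar by which the Young symmetrizer multiplies itself. -/
def youngScalar : ℂ := (exists_youngSym_conv_self (lam := lam)).choose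

theorem youngScalar_ne_zero : youngScalar lam ≠ 0 := exists_youngSym_conv_self.choose_spec.1

theorem youngSym_conv_self : conv (youngSym lam) (youngSym lam) = youngScalar lam • youngSym lam :=
  exists_youngSym_conv_self.choose_spec.2

variable (lam) in
/-- The normalized Young symmetrizer. -/
def youngIdem : (lam.cells ≃ lam.cells) → ℂ := (youngScalar lam)⁻¹ • youngSym lam

theorem youngIdem_ne_zero : youngIdem lam ≠ 0 :=
  smul_ne_zero (inv_ne_zero youngScalar_ne_zero) youngSym_ne_zero

theorem youngIdem_conv_self : conv (youngIdem lam) (youngIdem lam) = youngIdem lam := by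
  rw [youngIdem, map_smul, map_smul, LinearMap.smul_apply, youngSym_conv_self,
    inv_smul_smul₀ youngScalar_ne_zero]

theorem youngIdem_conv_of_ne (h : lam ≠ mu) (y : (lam.cells ≃ mu.cells) → ℂ) :
    conv (youngIdem mu) (conv y (youngIdem lam)) = 0 := by
  rw [youngIdem, youngIdem, map_smul, map_smul, map_smul, LinearMap.smul_apply,
    youngSym_conv_youngSym_of_ne h, smul_zero, smul_zero]

theorem exists_smul_youngIdem (y : (lam.cells ≃ lam.cells) → ℂ) :
    ∃ t : ℂ, conv (youngIdem lam) (conv y (youngIdem lam)) = t • youngIdem lam := by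
  obtain ⟨t, ht⟩ := exists_smul_youngSym
    (conv (symmetrizer (rowOf lam)) (conv y (antisymmetrizer (colOf lam))))
  refine ⟨(youngScalar lam)⁻¹ * t, ?_⟩
  rw [youngIdem, map_smul, map_smul, map_smul, LinearMap.smul_apply, mul_smul,
    smul_comm t, ← ht, youngSym, conv_assoc, conv_assoc, conv_assoc]

/-- The left ideal generated by a nonzero multiple of a Young symmetrizer contains it. -/
theorem exists_conv_eq_youngIdem {T : Type*} [Fintype T] [DecidableEq T]
    {y : (lam.cells ≃ T) → ℂ} (hy : conv y (youngIdem lam) = y) (h0 : y ≠ 0) :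
    ∃ z : (T ≃ lam.cells) → ℂ, conv z y = youngIdem lam := by
  set a := symmetrizer (rowOf lam) with ha
  set b := antisymmetrizer (colOf lam) with hb
  have hy' : y = (youngScalar lam)⁻¹ • conv (conv y b) a := by
    conv_lhs => rw [← hy, youngIdem, youngSym, map_smul, ← conv_assoc]
  -- Since y ends in b a, von Neumann's lemma makes b y* y a multiple t of the Young symmetrizer. If
  -- t = 0, then (y b)*(y b) = b y* y b = 0, which forces y b = 0 and y = 0.
  obtain ⟨t, ht⟩ := exists_smul_youngSym (conv (adj y) ((youngScalar lam)⁻¹ • (conv y b)))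
  have h1 : conv b (conv (adj y) y) = t • youngSym lam := by
    rw [← ht, conv_assoc]
    congr 2
    conv_lhs => rw [hy']
    rw [map_smul, LinearMap.smul_apply]
  have ht0 : t ≠ 0 := by
    rintro rfl
    rw [zero_smul] at h1
    have h2 : conv y b = 0 := by
      apply eq_zero_of_conv_adj_self
      rw [adj_conv, hb, adj_antisymmetrizer, ← hb, conv_assoc, ← conv_assoc (adj y), ← conv_assoc, h1]
      simp
    apply h0
    rw [hy', h2]
    simp
  refine ⟨(youngScalar lam)⁻¹ • t⁻¹ • conv b (adj y), ?_⟩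
  rw [map_smul, map_smul, LinearMap.smul_apply, LinearMap.smul_apply, conv_assoc, h1,
    inv_smul_smul₀ ht0, youngIdem]

end Young

/-! ### Traces and characters -/

section Characters

variable {S D U U' : Type*} [Fintype S] [DecidableEq S] [Fintype D] [DecidableEq D]
  [Fintype U] [DecidableEq U] [Fintype U'] [DecidableEq U']

/-- The two-sided multiplication `z ↦ f z e`. -/
def sandwich (f : (D ≃ D) → ℂ) (e : (S ≃ S) → ℂ) : ((S ≃ D) → ℂ) →ₗ[ℂ] ((S ≃ D) → ℂ) :=
  conv f ∘ₗ conv.flip e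

theorem sandwich_apply (f : (D ≃ D) → ℂ) (e : (S ≃ S) → ℂ) (z : (S ≃ D) → ℂ) :
    sandwich f e z = conv f (conv z e) := rfl

theorem trace_sandwich (f : (D ≃ D) → ℂ) (e : (S ≃ S) → ℂ) :
    LinearMap.trace ℂ _ (sandwich f e)
      = ∑ τ : S ≃ D, ∑ g : S ≃ S, e g * f ((τ.symm.trans g.symm).trans τ) := by
  rw [LinearMap.trace_eq_matrix_trace ℂ (Pi.basisFun ℂ (S ≃ D)), Matrix.trace]
  refine Finset.sum_congr rfl fun τ _ => ?_
  have h1 : (Pi.single τ 1 : (S ≃ D) → ℂ) = delta τ := by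
    ext σ; simp [delta, Pi.single_apply]
  rw [Matrix.diag_apply, LinearMap.toMatrix_apply, Pi.basisFun_apply, Pi.basisFun_repr,
    sandwich_apply, conv_apply, h1]
  symm
  refine Fintype.sum_equiv (transRight τ) _ _ fun g => ?_
  rw [conv_delta_left]
  congr 2
  ext; simp [transRight]

theorem sandwich_idem {f : (D ≃ D) → ℂ} {e : (S ≃ S) → ℂ} (hf : conv f f = f)
    (he : conv e e = e) (z : (S ≃ D) → ℂ) : sandwich f e (sandwich f e z) = sandwich f e z := by
  simp only [sandwich_apply]
  rw [conv_assoc, conv_assoc, he, ← conv_assoc, hf]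

theorem finrank_range_sandwich {f : (D ≃ D) → ℂ} {e : (S ≃ S) → ℂ} (hf : conv f f = f)
    (he : conv e e = e) :
    (Module.finrank ℂ (LinearMap.range (sandwich f e)) : ℂ)
      = LinearMap.trace ℂ _ (sandwich f e) := by
  refine (LinearMap.IsProj.trace (p := LinearMap.range (sandwich f e))
    ⟨fun x => LinearMap.mem_range_self _ x, ?_⟩).symm
  rintro _ ⟨z, rfl⟩
  exact sandwich_idem hf he z

/-- The character of a representation given by an idempotent `y`, as a class function on the
permutations of any finite set. -/
def chr (y : (S ≃ S) → ℂ) (g : U ≃ U) : ℂ := ∑ x : S ≃ U, y (x.trans (g.trans x.symm))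

/-- Conjugation by a bijection. -/
def conjEquiv (x : S ≃ U) : (S ≃ S) ≃ (U ≃ U) where
  toFun g := x.symm.trans (g.trans x)
  invFun g := x.trans (g.trans x.symm)
  left_inv g := by ext; simp
  right_inv g := by ext; simp

theorem chr_conj (y : (S ≃ S) → ℂ) (x : U ≃ U') (g : U ≃ U) :
    chr y (conjEquiv x g) = chr y g := by
  symm
  refine Fintype.sum_equiv (transRight x) _ _ fun z => ?_
  congr 1
  ext; simp [transRight, conjEquiv]

/-- The dimension formula for Hom by characters: once the bijection x in `chr e` is fixed, the
remaining sum is the trace, whatever x is; there are d! choices of x. -/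
theorem sum_chr_mul_chr (h : Fintype.card S = Fintype.card U) (f : (D ≃ D) → ℂ)
    (e : (S ≃ S) → ℂ) :
    ∑ g : U ≃ U, chr e g * chr f g.symm
      = (Fintype.card U).factorial * LinearMap.trace ℂ _ (sandwich f e) := by
  have h1 : ∀ x : S ≃ U, ∑ g : U ≃ U, ∑ z : D ≃ U,
      e (x.trans (g.trans x.symm)) * f (z.trans (g.symm.trans z.symm))
        = LinearMap.trace ℂ _ (sandwich f e) := by
    intro x
    rw [trace_sandwich, Finset.sum_comm]
    symm
    refine Fintype.sum_equiv ((transLeft x.symm).trans (Equiv.symmEquiv U D)) _ _ fun τ => ?_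
    refine Fintype.sum_equiv (conjEquiv x) _ _ fun g => ?_
    congr 2
    · ext; simp [conjEquiv]
    · ext; simp [conjEquiv, transLeft]
  have h2 : ∀ g : U ≃ U, chr e g * chr f g.symm = ∑ x : S ≃ U, ∑ z : D ≃ U,
      e (x.trans (g.trans x.symm)) * f (z.trans (g.symm.trans z.symm)) := fun g => by
    simp only [chr, Finset.sum_mul_sum]
  simp only [h2]
  rw [Finset.sum_comm]
  simp only [h1]
  rw [Finset.sum_const, Finset.card_univ, Fintype.card_equiv (Fintype.equivOfCardEq h), h,
    nsmul_eq_mul]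

/-- This counts the bijections that intertwine g and h: the order of a centralizer if they are
conjugate, and 0 otherwise. It is the kernel z(g,h) of the second orthogonality relation. -/
theorem chr_delta (g : S ≃ S) (h : U ≃ U) :
    chr (delta g) h = ((Finset.univ.filter fun x : S ≃ U => g.trans x = x.trans h).card : ℂ) := by
  rw [chr, Finset.cast_card, Finset.sum_filter]
  refine Finset.sum_congr rfl fun x _ => ?_
  rw [delta]
  congr 1
  refine propext ⟨?_, fun h => ?_⟩
  · rintro rfl; ext; simp
  · rw [← Equiv.trans_assoc, ← h]; ext; simp

theorem chr_delta_comm (g : S ≃ S) (h : U ≃ U) : chr (delta g) h = chr (delta h) g := by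
  rw [chr_delta, chr_delta]
  congr 1
  refine Finset.card_equiv (Equiv.symmEquiv S U) fun x => ?_
  simp only [Finset.mem_filter, Finset.mem_univ, true_and]
  change _ ↔ h.trans x.symm = x.symm.trans g
  constructor
  · intro hx; ext u
    have := congrArg (fun k => x.symm (k (x.symm u))) hx
    simpa using this.symm
  · intro hx; ext u
    have := congrArg (fun k => x (k (x u))) hx
    simpa using this.symm

theorem sum_chr_delta (h : Fintype.card S = Fintype.card U) (g : U ≃ U) :
    ∑ k : S ≃ S, chr (delta k) g = (Fintype.card U).factorial := by
  simp only [chr]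
  rw [Finset.sum_comm]
  simp only [delta, Finset.sum_ite_eq, Finset.mem_univ, if_true, Finset.sum_const,
    Finset.card_univ]
  rw [Fintype.card_equiv (Fintype.equivOfCardEq h), h, nsmul_eq_mul, mul_one]

theorem exists_conj_of_partition_eq {g h : U ≃ U}
    (hgh : Equiv.Perm.partition g = Equiv.Perm.partition h) :
    ∃ x : U ≃ U, conjEquiv x g = h := by
  obtain ⟨x, hx⟩ := isConj_iff.1 (Equiv.Perm.partition_eq_of_isConj.2 hgh)
  exact ⟨x, hx⟩

theorem chr_eq_of_partition_eq (y : (S ≃ S) → ℂ) {g h : U ≃ U}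
    (hgh : Equiv.Perm.partition g = Equiv.Perm.partition h) : chr y g = chr y h := by
  obtain ⟨x, rfl⟩ := exists_conj_of_partition_eq hgh
  rw [chr_conj]

theorem chr_symm_eq_of_partition_eq (y : (S ≃ S) → ℂ) {g h : U ≃ U}
    (hgh : Equiv.Perm.partition g = Equiv.Perm.partition h) : chr y g.symm = chr y h.symm := by
  obtain ⟨x, rfl⟩ := exists_conj_of_partition_eq hgh
  rw [← chr_conj y x]
  rfl

theorem chr_delta_eq_zero {g h : U ≃ U}
    (hgh : Equiv.Perm.partition g ≠ Equiv.Perm.partition h) : chr (delta g) h = 0 := by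
  rw [chr_delta, Nat.cast_eq_zero, Finset.card_eq_zero, Finset.filter_eq_empty_iff]
  intro x _ hx
  refine hgh (Equiv.Perm.partition_eq_of_isConj.1 (isConj_iff.2 ⟨x, ?_⟩))
  have : x * g = h * x := hx
  rw [this, mul_inv_cancel_right]

/-- A cycle type records only the parts that are at least 2; the parts equal to 1 reappear as the
number of fixed points. -/
theorem exists_perm_partition_eq (p : (Fintype.card U).Partition) :
    ∃ g : U ≃ U, Equiv.Perm.partition g = p := by
  have h1 : (p.parts.filter fun i => 2 ≤ i).sum ≤ Fintype.card U := by
    conv_rhs => rw [← p.parts_sum, ← Multiset.filter_add_not (fun i => 2 ≤ i) p.parts,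
      Multiset.sum_add]
    exact Nat.le_add_right _ _
  obtain ⟨g, hg⟩ := (Equiv.Perm.exists_with_cycleType_iff U).2
    ⟨h1, fun a ha => (Multiset.mem_filter.1 ha).2⟩
  refine ⟨g, Nat.Partition.ext ?_⟩
  rw [Equiv.Perm.parts_partition, hg, ← Equiv.Perm.sum_cycleType, hg]
  have h2 : p.parts.filter (fun i => ¬2 ≤ i)
      = Multiset.replicate (p.parts.filter fun i => ¬2 ≤ i).card 1 := by
    refine Multiset.eq_replicate_card.2 fun i hi => ?_
    have h3 := Multiset.mem_filter.1 hi
    have h4 := p.parts_pos h3.1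
    omega
  have h5 : Fintype.card U - (p.parts.filter fun i => 2 ≤ i).sum
      = (p.parts.filter fun i => ¬2 ≤ i).card := by
    have h6 := p.parts_sum
    rw [← Multiset.filter_add_not (fun i => 2 ≤ i) p.parts, Multiset.sum_add] at h6
    have h7 : (p.parts.filter fun i => ¬2 ≤ i).sum = (p.parts.filter fun i => ¬2 ≤ i).card := by
      conv_lhs => rw [h2]
      simp
    omega
  rw [h5, ← h2, Multiset.filter_add_not]

/-- Orbit–stabilizer: centralizer order times class size. -/
theorem chr_delta_mul_card (g : U ≃ U) :
    chr (delta g) g * (Finset.univ.filter fun k : U ≃ U =>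
      Equiv.Perm.partition k = Equiv.Perm.partition g).card = (Fintype.card U).factorial := by
  rw [← sum_chr_delta rfl g, mul_comm, ← nsmul_eq_mul, ← Finset.sum_const, Finset.sum_filter]
  refine Finset.sum_congr rfl fun k _ => ?_
  split_ifs with h
  · rw [chr_delta_comm k, chr_eq_of_partition_eq _ h]
  · rw [chr_delta_eq_zero h]

end Characters

/-! ### Orthogonality relations for the characters of the symmetric group -/

section Orthogonality

variable {lam mu : YoungDiagram}

theorem trace_sandwich_youngIdem_of_ne (h : lam ≠ mu) :
    LinearMap.trace ℂ _ (sandwich (youngIdem mu) (youngIdem lam)) = 0 := by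
  have : sandwich (youngIdem mu) (youngIdem lam) = 0 :=
    LinearMap.ext fun z => youngIdem_conv_of_ne h z
  rw [this, map_zero]

theorem trace_sandwich_youngIdem_self :
    LinearMap.trace ℂ _ (sandwich (youngIdem lam) (youngIdem lam)) = 1 := by
  rw [← finrank_range_sandwich youngIdem_conv_self youngIdem_conv_self]
  have : LinearMap.range (sandwich (youngIdem lam) (youngIdem lam))
      = Submodule.span ℂ {youngIdem lam} := by
    apply le_antisymm
    · rintro _ ⟨z, rfl⟩
      obtain ⟨t, ht⟩ := exists_smul_youngIdem z
      rw [sandwich_apply, ht]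
      exact Submodule.smul_mem _ _ (Submodule.mem_span_singleton_self _)
    · rw [Submodule.span_singleton_le_iff_mem]
      exact ⟨youngIdem lam, by rw [sandwich_apply, youngIdem_conv_self, youngIdem_conv_self]⟩
  rw [this, finrank_span_singleton youngIdem_ne_zero, Nat.cast_one]

theorem sum_rowLens (lam : YoungDiagram) : lam.rowLens.sum = lam.card := by
  rw [YoungDiagram.rowLens, YoungDiagram.card,
    Finset.card_eq_sum_card_fiberwise (f := Prod.fst) (t := Finset.range (lam.colLen 0))]
  · rw [Finset.sum_eq_multiset_sum, Finset.range_val, Multiset.range, Multiset.map_coe,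
      Multiset.sum_coe]
    refine congrArg List.sum (List.map_congr_left fun i _ => ?_)
    rw [YoungDiagram.rowLen_eq_card]
    rfl
  · intro c hc
    simp only [Finset.coe_range, Set.mem_Iio]
    exact YoungDiagram.mem_iff_lt_colLen.1 (lam.up_left_mem le_rfl (Nat.zero_le c.2) hc)

/-- Young diagrams and partitions. -/
def partitionOf {d : ℕ} (lam : {lam : YoungDiagram // lam.card = d}) : d.Partition where
  parts := lam.1.rowLens
  parts_pos h := lam.1.pos_of_mem_rowLens _ h
  parts_sum := by rw [Multiset.sum_coe, sum_rowLens, lam.2]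

theorem partitionOf_bijective (d : ℕ) : Function.Bijective (partitionOf (d := d)) := by
  constructor
  · intro l l' h
    have h1 : (l.1.rowLens : Multiset ℕ) = l'.1.rowLens := congrArg Nat.Partition.parts h
    have h2 := (Multiset.coe_eq_coe.1 h1).eq_of_sortedGE l.1.rowLens_sorted l'.1.rowLens_sorted
    exact Subtype.ext (YoungDiagram.equivListRowLens.injective (Subtype.ext h2))
  · intro p
    have h0 : (p.parts.sort (· ≥ ·)).SortedGE := (p.parts.pairwise_sort _).sortedGE
    have h1 : (YoungDiagram.ofRowLens _ h0).rowLens = p.parts.sort (· ≥ ·) :=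
      YoungDiagram.rowLens_ofRowLens_eq_self fun x hx =>
        p.parts_pos ((Multiset.mem_sort _).1 hx)
    have h2 : (((YoungDiagram.ofRowLens _ h0).rowLens : List ℕ) : Multiset ℕ) = p.parts := by
      rw [h1, Multiset.sort_eq]
    refine ⟨⟨YoungDiagram.ofRowLens _ h0, ?_⟩, Nat.Partition.ext h2⟩
    rw [← sum_rowLens, ← Multiset.sum_coe, h2, p.parts_sum]

instance (d : ℕ) : Fintype {lam : YoungDiagram // lam.card = d} :=
  Fintype.ofBijective _ (Equiv.ofBijective _ (partitionOf_bijective d)).symm.bijective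

theorem card_youngDiagram (d : ℕ) :
    Fintype.card {lam : YoungDiagram // lam.card = d} = Fintype.card d.Partition :=
  Fintype.card_of_bijective (partitionOf_bijective d)

theorem card_cells (lam : YoungDiagram) : Fintype.card lam.cells = lam.card :=
  Fintype.card_coe _

variable {U U' : Type*} [Fintype U] [DecidableEq U] [Fintype U'] [DecidableEq U']

open scoped Classical in
theorem sum_chr_youngIdem_mul (l l' : {lam : YoungDiagram // lam.card = Fintype.card U}) :
    ∑ g : U ≃ U, chr (youngIdem l.1) g * chr (youngIdem l'.1) g.symm
      = if l = l' then ((Fintype.card U).factorial : ℂ) else 0 := by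
  rw [sum_chr_mul_chr (by rw [card_cells, l.2])]
  split_ifs with h
  · subst h
    rw [trace_sandwich_youngIdem_self, mul_one]
  · rw [trace_sandwich_youngIdem_of_ne fun h' => h (Subtype.ext h'), mul_zero]

/-- The second orthogonality relation. -/
theorem sum_youngIdem_chr_mul_chr (g h : U ≃ U) :
    ∑ l : {lam : YoungDiagram // lam.card = Fintype.card U},
      chr (youngIdem l.1) g * chr (youngIdem l.1) h.symm = chr (delta g) h := by
  classical
  choose r hr using exists_perm_partition_eq (U := U)
  let cl : (Fintype.card U).Partition → ℂ := fun p =>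
    ((Finset.univ.filter fun k : U ≃ U => Equiv.Perm.partition k = p).card : ℂ)
  have hfac : ((Fintype.card U).factorial : ℂ) ≠ 0 := by
    exact_mod_cast (Fintype.card U).factorial_ne_zero
  -- M is the character table, and N is its transpose at inverse elements, weighted by class size
  -- over d!. The first orthogonality relation says M N = 1.
  let M : Matrix {lam : YoungDiagram // lam.card = Fintype.card U} (Fintype.card U).Partition ℂ :=
    fun l p => chr (youngIdem l.1) (r p)
  let N : Matrix (Fintype.card U).Partition {lam : YoungDiagram // lam.card = Fintype.card U} ℂ :=
    fun p l => cl p / (Fintype.card U).factorial * chr (youngIdem l.1) (r p).symm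
  have hMN : M * N = (1 : Matrix _ _ ℂ) := by
    ext l l'
    rw [Matrix.mul_apply, Matrix.one_apply]
    have h1 := sum_chr_youngIdem_mul l l'
    rw [← Finset.sum_fiberwise (s := Finset.univ) (g := Equiv.Perm.partition)] at h1
    have h2 : ∀ p, ∑ g : U ≃ U with Equiv.Perm.partition g = p,
        chr (youngIdem l.1) g * chr (youngIdem l'.1) g.symm
          = (Fintype.card U).factorial * (M l p * N p l') := by
      intro p
      rw [Finset.sum_congr rfl (g := fun _ => chr (youngIdem l.1) (r p) *
        chr (youngIdem l'.1) (r p).symm), Finset.sum_const, nsmul_eq_mul]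
      · simp only [M, N, cl]
        field_simp
      · intro g hg
        have h3 := (Finset.mem_filter.1 hg).2.trans (hr p).symm
        rw [chr_eq_of_partition_eq _ h3, chr_symm_eq_of_partition_eq _ h3]
    simp only [h2, ← Finset.mul_sum] at h1
    have h4 := congrArg (fun t => ((Fintype.card U).factorial : ℂ)⁻¹ * t) h1
    simp only [inv_mul_cancel_left₀ hfac] at h4
    rw [h4]
    split_ifs
    · exact inv_mul_cancel₀ hfac
    · exact mul_zero _
  -- The table is square, since partitions index both diagrams and classes, so the one-sided inverse
  -- is two-sided.
  have hNM : N * M = 1 := (Matrix.mul_eq_one_comm_of_card_eq _ _ _ (card_youngDiagram _)).1 hMN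
  have h1 := congrFun (congrFun hNM (Equiv.Perm.partition h)) (Equiv.Perm.partition g)
  rw [Matrix.mul_apply, Matrix.one_apply] at h1
  have h2 : ∀ l : {lam : YoungDiagram // lam.card = Fintype.card U},
      N (Equiv.Perm.partition h) l * M l (Equiv.Perm.partition g)
        = cl (Equiv.Perm.partition h) / (Fintype.card U).factorial *
          (chr (youngIdem l.1) g * chr (youngIdem l.1) h.symm) := by
    intro l
    simp only [M, N]
    rw [chr_symm_eq_of_partition_eq _ (hr (Equiv.Perm.partition h)),
      chr_eq_of_partition_eq _ (hr (Equiv.Perm.partition g))]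
    ring
  simp only [h2, ← Finset.mul_sum] at h1
  have h3 := chr_delta_mul_card h
  have h4 : cl (Equiv.Perm.partition h) ≠ 0 := right_ne_zero_of_mul (h3.trans_ne hfac)
  have h5 : cl (Equiv.Perm.partition h) / (Fintype.card U).factorial ≠ 0 := div_ne_zero h4 hfac
  apply mul_left_cancel₀ h5
  rw [h1]
  split_ifs with hgh
  · rw [chr_delta_comm, ← chr_eq_of_partition_eq _ hgh, ← h3, mul_comm]
    field_simp
    exact (mul_div_cancel_left₀ _ (left_ne_zero_of_mul (h3.trans_ne hfac))).symm
  · rw [chr_delta_eq_zero fun h => hgh h.symm, mul_zero]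

end Orthogonality

/-! ### External products and colorings -/

section Box

variable {ι : Type*} [Fintype ι] [DecidableEq ι] {S : ι → Type*} [∀ j, Fintype (S j)]
  [∀ j, DecidableEq (S j)] {U U' : Type*} [Fintype U] [DecidableEq U] [Fintype U'] [DecidableEq U']

/-- The external product of elements of group algebras of permutations. -/
def box (y : ∀ j, (S j ≃ S j) → ℂ) : ((Σ j, S j) ≃ (Σ j, S j)) → ℂ :=
  ∑ h : ∀ j, S j ≃ S j, (∏ j, y j (h j)) • delta (Equiv.sigmaCongrRight h)

theorem box_conv_box (y z : ∀ j, (S j ≃ S j) → ℂ) :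
    conv (box y) (box z) = box fun j => conv (y j) (z j) := by
  simp only [box, map_sum, LinearMap.sum_apply, map_smul, LinearMap.smul_apply, conv_delta_delta,
    conv_apply, Finset.prod_univ_sum, Finset.sum_smul, Fintype.piFinset_univ]
  conv_rhs => rw [Finset.sum_comm]
  refine Finset.sum_congr rfl fun k _ => ?_
  rw [Finset.smul_sum]
  refine Fintype.sum_equiv (Equiv.piCongrRight fun j => transLeft (k j)) _ _ fun h => ?_
  rw [smul_smul, ← Finset.prod_mul_distrib]
  congr 1
  refine Finset.prod_congr rfl fun j _ => ?_
  congr 2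
  ext; simp [transLeft]

theorem sigmaCongrRight_injective :
    Function.Injective (Equiv.sigmaCongrRight : (∀ j, S j ≃ S j) → ((Σ j, S j) ≃ (Σ j, S j))) := by
  intro h k hk
  funext j
  ext s
  have := congrArg (fun e => e ⟨j, s⟩) hk
  simpa using this

theorem box_apply_sigmaCongrRight (y : ∀ j, (S j ≃ S j) → ℂ) (h : ∀ j, S j ≃ S j) :
    box y (Equiv.sigmaCongrRight h) = ∏ j, y j (h j) := by
  rw [box, Finset.sum_apply, Finset.sum_eq_single h]
  · rw [Pi.smul_apply, delta_self, smul_eq_mul, mul_one]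
  · intro k _ hk
    rw [Pi.smul_apply, delta_of_ne fun h' => hk (sigmaCongrRight_injective h'.symm), smul_zero]
  · simp

theorem box_apply_eq_zero (y : ∀ j, (S j ≃ S j) → ℂ) {g : (Σ j, S j) ≃ (Σ j, S j)}
    (hg : ∀ h : ∀ j, S j ≃ S j, g ≠ Equiv.sigmaCongrRight h) : box y g = 0 := by
  rw [box, Finset.sum_apply]
  exact Finset.sum_eq_zero fun h _ => by rw [Pi.smul_apply, delta_of_ne (hg h), smul_zero]

theorem box_delta (g : ∀ j, S j ≃ S j) :
    box (fun j => delta (g j)) = delta (Equiv.sigmaCongrRight g) := by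
  rw [box, Finset.sum_eq_single g]
  · simp only [delta_self, Finset.prod_const_one, one_smul]
  · intro h _ hh
    obtain ⟨j, hj⟩ := Function.ne_iff.1 hh
    rw [Finset.prod_eq_zero (Finset.mem_univ j) (delta_of_ne hj), zero_smul]
  · simp

/-- A bijection from a disjoint union is a coloring with bijections onto the color classes. -/
def glue (p : Σ f : U → ι, ∀ j, S j ≃ {u // f u = j}) : (Σ j, S j) ≃ U :=
  (Equiv.sigmaCongrRight p.2).trans (Equiv.sigmaFiberEquiv p.1)

theorem glue_apply (f : U → ι) (ξ : ∀ j, S j ≃ {u // f u = j}) (j : ι) (s : S j) :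
    glue ⟨f, ξ⟩ ⟨j, s⟩ = ξ j s := rfl

theorem color_glue (f : U → ι) (ξ : ∀ j, S j ≃ {u // f u = j}) (c : Σ j, S j) :
    f (glue ⟨f, ξ⟩ c) = c.1 := (ξ c.1 c.2).2

theorem glue_bijective : Function.Bijective
    (glue : (Σ f : U → ι, ∀ j, S j ≃ {u // f u = j}) → ((Σ j, S j) ≃ U)) := by
  constructor
  · rintro ⟨f, ξ⟩ ⟨f', ξ'⟩ h
    have h1 : f = f' := by
      funext u
      obtain ⟨c, rfl⟩ := (glue ⟨f, ξ⟩).surjective u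
      rw [color_glue f ξ, h, color_glue f' ξ']
    subst h1
    congr 1
    funext j
    ext s
    rw [← glue_apply, ← glue_apply, h]
  · intro x
    refine ⟨⟨fun u => (x.symm u).1, fun j => Equiv.ofBijective
      (fun s => ⟨x ⟨j, s⟩, by simp⟩) ⟨?_, ?_⟩⟩, ?_⟩
    · intro s t hst
      simpa using hst
    · rintro ⟨u, rfl⟩
      exact ⟨(x.symm u).2, Subtype.ext (by simp)⟩
    · ext ⟨j, s⟩
      rfl

/-- The permutation of a color class of an invariant coloring. -/
def fiberPerm (g : U ≃ U) (f : {f : U → ι // ∀ u, f (g u) = f u}) (j : ι) :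
    {u // f.1 u = j} ≃ {u // f.1 u = j} :=
  g.subtypeEquiv fun u => by rw [f.2]

/-- The formula for an induced character. A bijection from the disjoint union is a coloring with
bijections onto its classes, and `box y` sees the conjugate of g only if g preserves the coloring.
-/
theorem chr_box (y : ∀ j, (S j ≃ S j) → ℂ) (g : U ≃ U) :
    chr (box y) g = ∑ f : {f : U → ι // ∀ u, f (g u) = f u}, ∏ j, chr (y j) (fiberPerm g f j) := by
  have h1 : chr (box y) g = ∑ f : U → ι, ∑ ξ : ∀ j, S j ≃ {u // f u = j},
      box y ((glue ⟨f, ξ⟩).trans (g.trans (glue ⟨f, ξ⟩).symm)) := by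
    rw [chr, ← Fintype.sum_sigma']
    exact (Fintype.sum_bijective glue glue_bijective _ _ fun _ => rfl).symm
  rw [h1, ← Fintype.sum_subtype_add_sum_subtype (fun f : U → ι => ∀ u, f (g u) = f u)]
  rw [Finset.sum_eq_zero (s := (Finset.univ : Finset {f : U → ι // ¬∀ u, f (g u) = f u})), add_zero]
  · refine Finset.sum_congr rfl fun f _ => ?_
    simp only [chr, Finset.prod_univ_sum, Fintype.piFinset_univ]
    refine Finset.sum_congr rfl fun ξ _ => ?_
    rw [← box_apply_sigmaCongrRight]
    congr 1
    ext c : 1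
    rw [Equiv.trans_apply, Equiv.trans_apply, Equiv.symm_apply_eq]
    obtain ⟨j, s⟩ := c
    change _ = ((ξ j) ((ξ j).symm (fiberPerm g f j (ξ j s))) : U)
    rw [Equiv.apply_symm_apply]
    rfl
  · rintro ⟨f, hf⟩ _
    refine Finset.sum_eq_zero fun ξ _ => box_apply_eq_zero y fun h hh => hf fun u => ?_
    obtain ⟨c, rfl⟩ := (glue ⟨f, ξ⟩).surjective u
    have h2 := congrArg (fun e => glue ⟨f, ξ⟩ (e c)) hh
    simp only [Equiv.trans_apply, Equiv.apply_symm_apply] at h2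
    rw [h2, color_glue f ξ, color_glue f ξ]
    rfl

theorem chr_box_symm (y : ∀ j, (S j ≃ S j) → ℂ) (g : U ≃ U) :
    chr (box y) g.symm
      = ∑ f : {f : U → ι // ∀ u, f (g u) = f u}, ∏ j, chr (y j) (fiberPerm g f j).symm := by
  rw [chr_box]
  refine Fintype.sum_equiv (Equiv.subtypeEquivRight fun f => ⟨fun h u => ?_, fun h u => ?_⟩) _ _
    fun f => rfl
  · rw [← h (g u), g.symm_apply_apply]
  · rw [← h (g.symm u), g.apply_symm_apply]

theorem chr_delta_sigma_fiberPerm (g : U ≃ U) (f : {f : U → ι // ∀ u, f (g u) = f u})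
    (h : U' ≃ U') :
    chr (delta (Equiv.sigmaCongrRight (fiberPerm g f))) h = chr (delta g) h := by
  rw [chr_delta_comm, ← chr_conj _ (Equiv.sigmaFiberEquiv f.1), chr_delta_comm]
  congr 2

end Box

/-! ### Orthogonality for tuples of diagrams, and the sum of squared traces -/

section Sums

variable {U U' : Type*} [Fintype U] [DecidableEq U] [Fintype U'] [DecidableEq U']

open scoped Classical in
/-- The Young diagrams with at most `d` cells. -/
def diagramsLE (d : ℕ) : Finset YoungDiagram :=
  (Finset.range (d + 1)).biUnion fun k =>
    (Finset.univ : Finset {lam : YoungDiagram // lam.card = k}).map (Function.Embedding.subtype _)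

theorem mem_diagramsLE {d : ℕ} {lam : YoungDiagram} : lam ∈ diagramsLE d ↔ lam.card ≤ d := by
  simp [diagramsLE]

theorem sum_diagramsLE {M : Type*} [AddCommMonoid M] {d k : ℕ} (hk : k ≤ d) (F : YoungDiagram → M)
    (hF : ∀ lam : YoungDiagram, lam.card ≠ k → F lam = 0) :
    ∑ lam ∈ diagramsLE d, F lam = ∑ l : {lam : YoungDiagram // lam.card = k}, F l.1 := by
  have h1 : ∑ l : {lam : YoungDiagram // lam.card = k}, F l.1
      = ∑ lam ∈ (Finset.univ : Finset {lam : YoungDiagram // lam.card = k}).map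
        (Function.Embedding.subtype _), F lam := by
    rw [Finset.sum_map]; rfl
  rw [h1]
  symm
  refine Finset.sum_subset (fun lam hlam => ?_) fun lam _ hlam => hF lam fun h => hlam ?_
  · obtain ⟨l, _, rfl⟩ := Finset.mem_map.1 hlam
    exact mem_diagramsLE.2 (l.2.trans_le hk)
  · exact Finset.mem_map.2 ⟨⟨lam, h⟩, Finset.mem_univ _, rfl⟩

theorem chr_eq_zero_of_card_ne {S : Type*} [Fintype S] [DecidableEq S]
    (h : Fintype.card S ≠ Fintype.card U) (y : (S ≃ S) → ℂ) (g : U ≃ U) : chr y g = 0 := by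
  have : IsEmpty (S ≃ U) := ⟨fun e => h (Fintype.card_congr e)⟩
  rw [chr, Finset.univ_eq_empty, Finset.sum_empty]

/-- Two different sets are allowed because the color classes of two colorings need not have equal
sizes; if the sizes differ, both sides vanish. -/
theorem sum_diagramsLE_chr_mul_chr {d : ℕ} (hd : Fintype.card U ≤ d) (g : U ≃ U) (h : U' ≃ U') :
    ∑ lam ∈ diagramsLE d, chr (youngIdem lam) g * chr (youngIdem lam) h.symm
      = chr (delta g) h := by
  by_cases hU : Fintype.card U = Fintype.card U'
  · rw [sum_diagramsLE hd _ fun lam hlam => by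
      rw [chr_eq_zero_of_card_ne (by rwa [card_cells]), zero_mul]]
    let x : U' ≃ U := Fintype.equivOfCardEq hU.symm
    rw [← chr_conj _ x h, ← sum_youngIdem_chr_mul_chr]
    refine Finset.sum_congr rfl fun l _ => ?_
    rw [← chr_conj _ x h.symm]
    rfl
  · rw [chr_eq_zero_of_card_ne hU]
    refine Finset.sum_eq_zero fun lam _ => ?_
    by_cases h1 : Fintype.card lam.cells = Fintype.card U
    · rw [chr_eq_zero_of_card_ne (h1.trans_ne hU) _ h.symm, mul_zero]
    · rw [chr_eq_zero_of_card_ne h1, zero_mul]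

variable (m : ℕ)

/-- The number of colorings that are invariant under a permutation. -/
def fixCount (g : U ≃ U) : ℕ := Fintype.card {f : U → Fin m // ∀ u, f (g u) = f u}

/-- The idempotent of a tuple of Young diagrams. -/
def tupleIdem {m : ℕ} (mu : Fin m → YoungDiagram) :
    ((Σ j, (mu j).cells) ≃ (Σ j, (mu j).cells)) → ℂ := box fun j => youngIdem (mu j)

theorem tupleIdem_conv_self {m : ℕ} (mu : Fin m → YoungDiagram) :
    conv (tupleIdem mu) (tupleIdem mu) = tupleIdem mu := by
  rw [tupleIdem, box_conv_box]
  simp only [youngIdem_conv_self]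

/-- Expand over pairs of invariant colorings, f of g and f' of h, and apply orthogonality in each
color. For fixed f, the sum over f' is the expansion by `chr_box` of the character of the glued
permutation, which is g again. Each f thus contributes `chr (delta g) h`. -/
theorem sum_chr_tupleIdem_mul_chr {d : ℕ} (hd : Fintype.card U ≤ d) (g : U ≃ U) (h : U' ≃ U') :
    ∑ mu ∈ Fintype.piFinset fun _ : Fin m => diagramsLE d,
      chr (tupleIdem mu) g * chr (tupleIdem mu) h.symm = fixCount m g * chr (delta g) h := by
  have h1 : ∀ f : {f : U → Fin m // ∀ u, f (g u) = f u},
      ∑ f' : {f : U' → Fin m // ∀ u, f (h u) = f u},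
      ∑ mu ∈ Fintype.piFinset fun _ : Fin m => diagramsLE d,
        ∏ j, chr (youngIdem (mu j)) (fiberPerm g f j) *
          chr (youngIdem (mu j)) (fiberPerm h f' j).symm = chr (delta g) h := by
    intro f
    rw [← chr_delta_sigma_fiberPerm g f h, ← box_delta, chr_box]
    refine Finset.sum_congr rfl fun f' _ => ?_
    rw [← Finset.prod_univ_sum (fun _ : Fin m => diagramsLE d) fun j lam =>
      chr (youngIdem lam) (fiberPerm g f j) * chr (youngIdem lam) (fiberPerm h f' j).symm]
    refine Finset.prod_congr rfl fun j _ => ?_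
    exact sum_diagramsLE_chr_mul_chr ((Fintype.card_subtype_le _).trans hd) _ _
  have h2 := Finset.sum_congr (rfl : Finset.univ = Finset.univ) fun f _ => h1 f
  rw [Finset.sum_const, Finset.card_univ, nsmul_eq_mul] at h2
  rw [fixCount, ← h2]
  simp only [tupleIdem, chr_box_symm, chr_box _ g, Finset.sum_mul_sum, ← Finset.prod_mul_distrib]
  rw [Finset.sum_comm]
  refine Finset.sum_congr rfl fun f _ => ?_
  rw [Finset.sum_comm]

theorem eq_of_sameCycle {α : Type*} {g : U ≃ U} {f : U → α} (hf : ∀ u, f (g u) = f u) {u v : U}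
    (h : Equiv.Perm.SameCycle g u v) : f u = f v := by
  obtain ⟨i, rfl⟩ := h
  have h1 : ∀ (n : ℕ) u, f ((g ^ n : Equiv.Perm U) u) = f u := by
    intro n
    induction n with
    | zero => intro u; rfl
    | succ n ih => intro u; rw [pow_succ, Equiv.Perm.mul_apply, ih, hf]
  cases i with
  | ofNat n => exact (h1 n u).symm
  | negSucc n =>
    rw [zpow_negSucc]
    have h2 := h1 (n + 1) ((g ^ (n + 1) : Equiv.Perm U)⁻¹ u)
    rwa [← Equiv.Perm.mul_apply, mul_inv_cancel, Equiv.Perm.one_apply] at h2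

/-- The cycle of an element. -/
def cycleIndex (g : Equiv.Perm U) (u : U) : g.cycleFactorsFinset ⊕ {u // g u = u} :=
  if h : g u = u then Sum.inr ⟨u, h⟩ else
    Sum.inl ⟨g.cycleOf u, Equiv.Perm.cycleOf_mem_cycleFactorsFinset_iff.2
      (Equiv.Perm.mem_support.2 h)⟩

theorem cycleIndex_surjective (g : Equiv.Perm U) : Function.Surjective (cycleIndex g) := by
  rintro (⟨c, hc⟩ | ⟨u, hu⟩)
  · obtain ⟨hc1, hc2⟩ := Equiv.Perm.mem_cycleFactorsFinset_iff.1 hc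
    obtain ⟨u, hu⟩ := hc1.nonempty_support
    have h1 := Equiv.Perm.cycle_is_cycleOf hu hc
    have h2 : ¬g u = u := Equiv.Perm.mem_support.1
      (Equiv.Perm.mem_cycleFactorsFinset_support_le hc hu)
    refine ⟨u, ?_⟩
    rw [cycleIndex, dif_neg h2]
    exact congrArg Sum.inl (Subtype.ext h1.symm)
  · exact ⟨u, by rw [cycleIndex, dif_pos hu]⟩

theorem cycleIndex_apply_self (g : Equiv.Perm U) (u : U) :
    cycleIndex g (g u) = cycleIndex g u := by
  unfold cycleIndex
  by_cases h : g u = u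
  · have h' : g (g u) = g u := congrArg g h
    rw [dif_pos h, dif_pos h']
    exact congrArg Sum.inr (Subtype.ext h)
  · have h' : ¬g (g u) = g u := fun h' => h (g.injective h')
    rw [dif_neg h, dif_neg h']
    exact congrArg Sum.inl (Subtype.ext (Equiv.Perm.cycleOf_self_apply g u))

theorem sameCycle_of_cycleIndex_eq {g : Equiv.Perm U} {u v : U}
    (h : cycleIndex g u = cycleIndex g v) : g.SameCycle u v := by
  unfold cycleIndex at h
  split_ifs at h with h1 h2 h2
  · have : u = v := by simpa using h
    rw [this]
  · have h3 : g.cycleOf u = g.cycleOf v := by simpa using h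
    exact (Equiv.Perm.sameCycle_iff_cycleOf_eq_of_mem_support (Equiv.Perm.mem_support.2 h1)
      (Equiv.Perm.mem_support.2 h2)).2 h3

/-- An invariant coloring is a free choice of color on each cycle, fixed points included. -/
theorem fixCount_eq_pow (g : Equiv.Perm U) :
    fixCount m g = m ^ (Equiv.Perm.partition g).parts.card := by
  have h1 : Fintype.card (g.cycleFactorsFinset ⊕ {u // g u = u} → Fin m)
      = m ^ (Equiv.Perm.partition g).parts.card := by
    rw [Fintype.card_fun, Fintype.card_fin, Fintype.card_sum, Equiv.Perm.parts_partition,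
      Multiset.card_add, Multiset.card_replicate, Fintype.card_coe]
    congr 2
    · rw [Equiv.Perm.cycleType_def, Multiset.card_map]; rfl
    · rw [← Equiv.Perm.sum_cycleType, ← Equiv.Perm.card_fixedPoints]
      rfl
  rw [fixCount, ← h1]
  symm
  refine Fintype.card_of_bijective (f := fun φ => ⟨fun u => φ (cycleIndex g u), fun u =>
    congrArg φ (cycleIndex_apply_self g u)⟩) ⟨?_, ?_⟩
  · intro φ φ' h
    funext c
    obtain ⟨u, rfl⟩ := cycleIndex_surjective g c
    exact congrFun (congrArg Subtype.val h) u
  · rintro ⟨f, hf⟩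
    refine ⟨fun c => f (Function.surjInv (cycleIndex_surjective g) c), Subtype.ext (funext fun u => ?_)⟩
    exact eq_of_sameCycle hf (sameCycle_of_cycleIndex_eq (Function.surjInv_eq _ _))

theorem chr_delta_sq_eq (g h : U ≃ U) :
    chr (delta g) h * chr (delta h) g = chr (delta g) h * chr (delta h) h := by
  by_cases hgh : Equiv.Perm.partition g = Equiv.Perm.partition h
  · rw [chr_eq_of_partition_eq _ hgh]
  · rw [chr_delta_eq_zero hgh, zero_mul, zero_mul]

/-- Each conjugacy class contributes its size times the centralizer order, which is d!, times
m^(number of cycles). -/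
theorem sum_fixCount_mul_chr_delta :
    ∑ h : U ≃ U, fixCount m h * chr (delta h) h = (Fintype.card U).factorial *
      ∑ p : (Fintype.card U).Partition, (m : ℂ) ^ p.parts.card := by
  rw [← Finset.sum_fiberwise (s := Finset.univ) (g := Equiv.Perm.partition), Finset.mul_sum]
  refine Finset.sum_congr rfl fun p _ => ?_
  obtain ⟨r, rfl⟩ := exists_perm_partition_eq p
  rw [Finset.sum_congr rfl (g := fun _ =>
    (m : ℂ) ^ (Equiv.Perm.partition r).parts.card * chr (delta r) r), Finset.sum_const,
    nsmul_eq_mul, ← chr_delta_mul_card r]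
  · ring
  · intro h hh
    have h1 := (Finset.mem_filter.1 hh).2
    rw [fixCount_eq_pow, h1, chr_eq_of_partition_eq _ h1, chr_delta_comm,
      chr_eq_of_partition_eq _ h1, Nat.cast_pow]

/-- The multiplicity, as the trace of an idempotent. -/
def traceMult {m : ℕ} (lam : YoungDiagram) (mu : Fin m → YoungDiagram) : ℂ :=
  LinearMap.trace ℂ _ (sandwich (tupleIdem mu) (youngIdem lam))

theorem sum_comm_four {M α β γ δ : Type*} [AddCommMonoid M] (A : Finset α) (B : Finset β)
    (C : Finset γ) (D : Finset δ) (F : α → β → γ → δ → M) :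
    ∑ a ∈ A, ∑ b ∈ B, ∑ c ∈ C, ∑ d ∈ D, F a b c d
      = ∑ d ∈ D, ∑ c ∈ C, ∑ a ∈ A, ∑ b ∈ B, F a b c d := by
  rw [Finset.sum_comm (s := D), Finset.sum_congr rfl fun a _ => Finset.sum_comm (s := B),
    Finset.sum_comm (s := A)]
  refine Finset.sum_congr rfl fun c _ => ?_
  rw [Finset.sum_congr rfl fun a _ => Finset.sum_comm (s := B), Finset.sum_comm (s := A)]

/-- Write each square as a double sum over g and h, and sum over λ and μ first: the two
orthogonality relations leave fix(h) z(h,h) z(g,h). Summing z(g,h) over g gives d!, which cancels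
one of the two factorials. -/
theorem sum_traceMult_sq (d : ℕ) :
    ∑ l : {lam : YoungDiagram // lam.card = d},
      ∑ mu ∈ Fintype.piFinset fun _ : Fin m => diagramsLE d, traceMult l.1 mu ^ 2
      = ∑ p : d.Partition, (m : ℂ) ^ p.parts.card := by
  obtain ⟨U, _, _, rfl⟩ : ∃ (U : Type) (_ : Fintype U) (_ : DecidableEq U), Fintype.card U = d :=
    ⟨Fin d, inferInstance, inferInstance, Fintype.card_fin d⟩
  have hfac : ((Fintype.card U).factorial : ℂ) ≠ 0 := by
    exact_mod_cast (Fintype.card U).factorial_ne_zero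
  have h1 : ∀ (l : {lam : YoungDiagram // lam.card = Fintype.card U}) (mu : Fin m → YoungDiagram),
      ((Fintype.card U).factorial : ℂ) ^ 2 * traceMult l.1 mu ^ 2
      = ∑ g : U ≃ U, ∑ h : U ≃ U, (chr (youngIdem l.1) g * chr (youngIdem l.1) h.symm) *
        (chr (tupleIdem mu) h * chr (tupleIdem mu) g.symm) := by
    intro l mu
    have h2 := sum_chr_mul_chr (U := U) (by rw [card_cells, l.2]) (tupleIdem mu) (youngIdem l.1)
    -- One factor of the square is reindexed by inversion, so that the product pairs g with h⁻¹ for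
    -- λ and h with g⁻¹ for μ, as orthogonality requires.
    have h3 : ∑ g : U ≃ U, chr (youngIdem l.1) g.symm * chr (tupleIdem mu) g
        = ∑ g : U ≃ U, chr (youngIdem l.1) g * chr (tupleIdem mu) g.symm :=
      Fintype.sum_equiv (Equiv.symmEquiv U U) _ _ fun g => rfl
    rw [← mul_pow, traceMult, ← h2, sq]
    nth_rw 2 [← h3]
    rw [Finset.sum_mul_sum]
    refine Finset.sum_congr rfl fun g _ => Finset.sum_congr rfl fun h _ => ?_
    ring
  apply mul_left_cancel₀ (pow_ne_zero 2 hfac)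
  simp only [Finset.mul_sum, h1]
  have h4 : ∀ g h : U ≃ U, ∑ l : {lam : YoungDiagram // lam.card = Fintype.card U},
      ∑ mu ∈ Fintype.piFinset fun _ : Fin m => diagramsLE (Fintype.card U),
        (chr (youngIdem l.1) g * chr (youngIdem l.1) h.symm) *
          (chr (tupleIdem mu) h * chr (tupleIdem mu) g.symm)
      = fixCount m h * chr (delta h) h * chr (delta g) h := by
    intro g h
    rw [← Finset.sum_mul_sum, sum_youngIdem_chr_mul_chr, sum_chr_tupleIdem_mul_chr m le_rfl]
    linear_combination (fixCount m h : ℂ) * chr_delta_sq_eq g h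
  have h5 : ∑ l : {lam : YoungDiagram // lam.card = Fintype.card U},
      ∑ mu ∈ Fintype.piFinset fun _ : Fin m => diagramsLE (Fintype.card U),
        ∑ g : U ≃ U, ∑ h : U ≃ U, (chr (youngIdem l.1) g * chr (youngIdem l.1) h.symm) *
          (chr (tupleIdem mu) h * chr (tupleIdem mu) g.symm)
      = ∑ h : U ≃ U, ∑ g : U ≃ U, fixCount m h * chr (delta h) h * chr (delta g) h := by
    simp only [← h4]
    exact sum_comm_four _ _ _ _ _
  rw [h5, ← Finset.mul_sum, sq, mul_assoc, ← sum_fixCount_mul_chr_delta, Finset.mul_sum]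
  refine Finset.sum_congr rfl fun h _ => ?_
  rw [← Finset.mul_sum, sum_chr_delta rfl, mul_comm]

end Sums

/-! ### Bijections acting on tensor powers -/

section TensorPower

variable {S T R : Type*} [Fintype S] [DecidableEq S] [Fintype T] [DecidableEq T]
  [Fintype R] [DecidableEq R] (n : ℕ)

/-- The map of tensor powers that permutes the tensor factors. -/
def permMap (τ : S ≃ T) : (⨂[ℂ] _c : S, (Fin n → ℂ)) →ₗ[ℂ] (⨂[ℂ] _c : T, (Fin n → ℂ)) :=
  (PiTensorProduct.reindex ℂ (fun _ : S => Fin n → ℂ) τ).toLinearMap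

theorem permMap_tprod (τ : S ≃ T) (v : S → Fin n → ℂ) :
    permMap n τ (PiTensorProduct.tprod ℂ v) = PiTensorProduct.tprod ℂ fun c => v (τ.symm c) :=
  PiTensorProduct.reindex_tprod τ v

theorem permMap_comp (τ : T ≃ R) (σ : S ≃ T) :
    permMap n τ ∘ₗ permMap n σ = permMap n (σ.trans τ) := by
  refine PiTensorProduct.ext (MultilinearMap.ext fun v => ?_)
  simp only [LinearMap.compMultilinearMap_apply, LinearMap.comp_apply, permMap_tprod]
  rfl

theorem sum_comp {E F G κ : Type*} [AddCommMonoid E] [Module ℂ E] [AddCommMonoid F] [Module ℂ F]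
    [AddCommMonoid G] [Module ℂ G] (s : Finset κ) (f : κ → F →ₗ[ℂ] G) (g : E →ₗ[ℂ] F) :
    (∑ i ∈ s, f i) ∘ₗ g = ∑ i ∈ s, f i ∘ₗ g := by
  ext; simp [LinearMap.sum_apply]

theorem comp_sum {E F G κ : Type*} [AddCommMonoid E] [Module ℂ E] [AddCommMonoid F] [Module ℂ F]
    [AddCommMonoid G] [Module ℂ G] (s : Finset κ) (f : κ → E →ₗ[ℂ] F) (g : F →ₗ[ℂ] G) :
    g ∘ₗ (∑ i ∈ s, f i) = ∑ i ∈ s, g ∘ₗ f i := by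
  ext; simp [LinearMap.sum_apply]

/-- The action of the linearized bijections on tensor powers. -/
def op : ((S ≃ T) → ℂ) →ₗ[ℂ] (⨂[ℂ] _c : S, (Fin n → ℂ)) →ₗ[ℂ] (⨂[ℂ] _c : T, (Fin n → ℂ)) :=
  Fintype.linearCombination ℂ (permMap n)

theorem op_eq_sum (y : (S ≃ T) → ℂ) : op n y = ∑ τ, y τ • permMap n τ := rfl

theorem op_delta (τ : S ≃ T) : op n (delta τ) = permMap n τ := by
  rw [op_eq_sum, Finset.sum_eq_single τ]
  · rw [delta_self, one_smul]
  · intro σ _ h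
    rw [delta_of_ne h, zero_smul]
  · simp

theorem op_conv (y : (T ≃ R) → ℂ) (z : (S ≃ T) → ℂ) : op n (conv y z) = op n y ∘ₗ op n z := by
  rw [conv_eq_sum_left, op_eq_sum n y, map_sum, sum_comp]
  refine Finset.sum_congr rfl fun τ _ => ?_
  rw [map_smul, LinearMap.smul_comp, conv_eq_sum_right, op_eq_sum n z, map_sum, comp_sum]
  congr 1
  refine Finset.sum_congr rfl fun σ _ => ?_
  rw [map_smul, LinearMap.comp_smul, conv_delta_delta, op_delta, permMap_comp]

theorem op_conv_apply (y : (T ≃ R) → ℂ) (z : (S ≃ T) → ℂ) (w : ⨂[ℂ] _c : S, (Fin n → ℂ)) :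
    op n (conv y z) w = op n y (op n z w) := by
  rw [op_conv]; rfl

variable (S) in
/-- The diagonal action of a matrix on a tensor power. -/
def diagAct (X : Matrix (Fin n) (Fin n) ℂ) :
    (⨂[ℂ] _c : S, (Fin n → ℂ)) →ₗ[ℂ] (⨂[ℂ] _c : S, (Fin n → ℂ)) :=
  PiTensorProduct.map fun _ => X.mulVecLin

theorem diagAct_tprod (X : Matrix (Fin n) (Fin n) ℂ) (v : S → Fin n → ℂ) :
    diagAct S n X (PiTensorProduct.tprod ℂ v) = PiTensorProduct.tprod ℂ fun c => X.mulVec (v c) :=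
  PiTensorProduct.map_tprod _ _

theorem op_diagAct (X : Matrix (Fin n) (Fin n) ℂ) (y : (S ≃ T) → ℂ) :
    op n y ∘ₗ diagAct S n X = diagAct T n X ∘ₗ op n y := by
  rw [op_eq_sum, sum_comp, comp_sum]
  refine Finset.sum_congr rfl fun τ _ => ?_
  rw [LinearMap.smul_comp, LinearMap.comp_smul]
  congr 1
  refine PiTensorProduct.ext (MultilinearMap.ext fun v => ?_)
  simp only [LinearMap.compMultilinearMap_apply, LinearMap.comp_apply, permMap_tprod,
    diagAct_tprod]

theorem op_diagAct_apply (X : Matrix (Fin n) (Fin n) ℂ) (y : (S ≃ T) → ℂ)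
    (w : ⨂[ℂ] _c : S, (Fin n → ℂ)) : op n y (diagAct S n X w) = diagAct T n X (op n y w) :=
  congrArg (fun F => F w) (op_diagAct n X y)

variable (S) in
/-- The standard basis of a tensor power. -/
def tensorBasis : Module.Basis (S → Fin n) ℂ (⨂[ℂ] _c : S, (Fin n → ℂ)) :=
  Basis.piTensorProduct fun _ => Pi.basisFun ℂ (Fin n)

theorem tensorBasis_apply (φ : S → Fin n) :
    tensorBasis S n φ = PiTensorProduct.tprod ℂ fun c => stdVec n (φ c) := by
  rw [tensorBasis, Basis.piTensorProduct_apply]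
  congr 1
  funext c
  ext k
  simp [stdVec, Pi.single_apply, Fin.ext_iff]

theorem tensorBasis_repr_tprod (v : S → Fin n → ℂ) (φ : S → Fin n) :
    (tensorBasis S n).repr (PiTensorProduct.tprod ℂ v) φ = ∏ c, v c (φ c) := by
  simp [tensorBasis, Basis.piTensorProduct_repr_tprod_apply]

end TensorPower

/-! ### Polarization and density of invertible matrices -/

section Polarization

variable {S : Type*} [Fintype S] [DecidableEq S] {E : Type*} [AddCommGroup E] [Module ℂ E]

/-- Expand ∏_c (-1 + [c ∉ B]); the factor of any c outside B is zero. -/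
theorem sum_superset_neg_one_pow (B : Finset S) :
    ∑ A : Finset S, (if B ⊆ A then (-1 : ℂ) ^ A.card else 0)
      = if B = Finset.univ then (-1) ^ Fintype.card S else 0 := by
  have h1 := Finset.prod_add (fun _ : S => (-1 : ℂ)) (fun c => if c ∈ B then (0 : ℂ) else 1) Finset.univ
  have h2 : ∀ A : Finset S, (∏ _c ∈ A, (-1 : ℂ)) * ∏ c ∈ Finset.univ \ A, (if c ∈ B then (0 : ℂ) else 1)
      = if B ⊆ A then (-1 : ℂ) ^ A.card else 0 := by
    intro A
    rw [Finset.prod_const]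
    split_ifs with h
    · rw [Finset.prod_eq_one, mul_one]
      intro c hc
      exact if_neg fun hB => (Finset.mem_sdiff.1 hc).2 (h hB)
    · obtain ⟨c, hc, hcA⟩ := Finset.not_subset.1 h
      refine mul_eq_zero_of_right _ (Finset.prod_eq_zero (i := c) ?_ (if_pos hc))
      exact Finset.mem_sdiff.2 ⟨Finset.mem_univ c, hcA⟩
  simp only [h2, Finset.powerset_univ] at h1
  rw [← h1]
  split_ifs with h
  · subst h
    simp [Finset.prod_const]
  · obtain ⟨c, hc⟩ : ∃ c, c ∉ B := by
      by_contra! h'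
      exact h (Finset.eq_univ_of_forall h')
    exact Finset.prod_eq_zero (Finset.mem_univ c) (by simp [hc])

/-- Polarization: a multilinear form that vanishes on the families that are constant on the blocks
of a labelling vanishes on the symmetrizations along the blocks. -/
theorem sum_perm_eq_zero_of_forall_const {α : Type*} [DecidableEq α] (r : S → α)
    (f : MultilinearMap ℂ (fun _ : S => E) ℂ) (hf : ∀ w : α → E, f (fun c => w (r c)) = 0)
    (v : S → E) :
    ∑ p : S ≃ S, (if ∀ c, r (p c) = r c then f (fun c => v (p c)) else 0) = 0 := by
  -- Taking w i to be the sum of v over the elements of A in block i and expanding gives the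
  -- block-preserving maps with image in A.
  have h1 : ∀ A : Finset S, ∑ φ : S → S,
      (if (∀ c, r (φ c) = r c) ∧ Finset.univ.image φ ⊆ A then f (fun c => v (φ c)) else 0) = 0 := by
    intro A
    have h2 := hf fun i => ∑ c' ∈ A.filter fun c' => r c' = i, v c'
    rw [MultilinearMap.map_sum_finset] at h2
    refine Eq.trans ?_ h2
    rw [← Finset.sum_filter]
    refine Finset.sum_congr ?_ fun _ _ => rfl
    ext φ
    simp only [Finset.mem_filter, Finset.mem_univ, true_and, Fintype.mem_piFinset,
      Finset.image_subset_iff, forall_const]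
    exact ⟨fun h c => ⟨h.2 c, h.1 c⟩, fun h => ⟨fun c => (h c).2, fun c => (h c).1⟩⟩
  -- Inclusion–exclusion over A keeps only the surjective maps, hence the permutations.
  have h3 : ∑ A : Finset S, (-1 : ℂ) ^ A.card * ∑ φ : S → S,
      (if (∀ c, r (φ c) = r c) ∧ Finset.univ.image φ ⊆ A then f (fun c => v (φ c)) else 0) = 0 :=
    Finset.sum_eq_zero fun A _ => by rw [h1, mul_zero]
  simp only [Finset.mul_sum] at h3
  rw [Finset.sum_comm] at h3
  have h4 : ∀ φ : S → S, ∑ A : Finset S, (-1 : ℂ) ^ A.card *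
      (if (∀ c, r (φ c) = r c) ∧ Finset.univ.image φ ⊆ A then f (fun c => v (φ c)) else 0)
      = if Function.Bijective φ then (-1) ^ Fintype.card S *
        (if ∀ c, r (φ c) = r c then f (fun c => v (φ c)) else 0) else 0 := by
    intro φ
    have h5 : Function.Bijective φ ↔ Finset.univ.image φ = Finset.univ := by
      rw [← Finite.surjective_iff_bijective, ← Finset.coe_eq_univ,
        Finset.coe_image, Finset.coe_univ, Set.image_univ, Set.range_eq_univ]
    by_cases hr : ∀ c, r (φ c) = r c
    · simp only [hr, implies_true, true_and, if_true, mul_ite, mul_zero]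
      have h6 := congrArg (fun t => t * f (fun c => v (φ c)))
        (sum_superset_neg_one_pow (Finset.univ.image φ))
      simp only [Finset.sum_mul, ite_mul, zero_mul] at h6
      simp only [h5]
      exact h6
    · simp [hr]
  simp only [h4] at h3
  have h7 : ∑ φ : S → S, (if Function.Bijective φ then (-1) ^ Fintype.card S *
        (if ∀ c, r (φ c) = r c then f (fun c => v (φ c)) else 0) else 0)
      = (-1) ^ Fintype.card S *
        ∑ p : S ≃ S, (if ∀ c, r (p c) = r c then f (fun c => v (p c)) else 0) := by
    rw [← Finset.sum_filter, Finset.mul_sum]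
    symm
    refine Finset.sum_bij (fun p _ => ⇑p) (fun p _ => ?_) (fun p _ q _ h => ?_) (fun φ hφ => ?_)
      fun p _ => rfl
    · exact Finset.mem_filter.2 ⟨Finset.mem_univ _, p.bijective⟩
    · exact DFunLike.coe_injective h
    · exact ⟨Equiv.ofBijective φ (Finset.mem_filter.1 hφ).2, Finset.mem_univ _, rfl⟩
  rw [h7] at h3
  exact (mul_eq_zero.1 h3).resolve_left (pow_ne_zero _ (by norm_num))

/-- Density along the line X + s: the value is a polynomial Q in s that vanishes wherever X + s is
invertible. So Q times the characteristic polynomial of -X is zero, hence Q = 0, and s = 0 gives the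
claim. -/
theorem multilinear_apply_eq_zero_of_forall_det_ne_zero {n : ℕ}
    (f : MultilinearMap ℂ (fun _ : S => Fin n → ℂ) ℂ) (e : S → Fin n → ℂ)
    (hf : ∀ X : Matrix (Fin n) (Fin n) ℂ, X.det ≠ 0 → f (fun c => X.mulVec (e c)) = 0)
    (X : Matrix (Fin n) (Fin n) ℂ) : f (fun c => X.mulVec (e c)) = 0 := by
  let Q : Polynomial ℂ := ∑ A : Finset S, Polynomial.C
    (f (A.piecewise (fun c => X.mulVec (e c)) e)) * Polynomial.X ^ (Fintype.card S - A.card)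
  have hQ : ∀ s : ℂ, Q.eval s = f (fun c => (X + Matrix.scalar (Fin n) s).mulVec (e c)) := by
    intro s
    have h1 : (fun c => (X + Matrix.scalar (Fin n) s).mulVec (e c))
        = (fun c => X.mulVec (e c)) + fun c => s • e c := by
      funext c
      rw [Matrix.add_mulVec, Pi.add_apply]
      congr 1
      ext k
      simp [Matrix.scalar_apply, Matrix.mulVec_diagonal]
    rw [h1, MultilinearMap.map_add_univ, Polynomial.eval_finsetSum]
    refine Finset.sum_congr rfl fun A _ => ?_
    simp only [Polynomial.eval_mul, Polynomial.eval_C, Polynomial.eval_pow, Polynomial.eval_X]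
    have h2 : A.piecewise (fun c => X.mulVec (e c)) (fun c => s • e c)
        = Aᶜ.piecewise (fun c => s • A.piecewise (fun c => X.mulVec (e c)) e c)
          (A.piecewise (fun c => X.mulVec (e c)) e) := by
      funext c
      by_cases hc : c ∈ A
      · simp [hc]
      · simp [hc]
    rw [h2, MultilinearMap.map_piecewise_smul, Finset.prod_const, Finset.card_compl, smul_eq_mul,
      mul_comm]
  have h3 : Q * (-X).charpoly = 0 := by
    refine Polynomial.funext fun s => ?_
    rw [Polynomial.eval_mul, Polynomial.eval_zero, Matrix.eval_charpoly, hQ]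
    by_cases h : (X + Matrix.scalar (Fin n) s).det = 0
    · rw [sub_neg_eq_add, add_comm (Matrix.scalar _ s), h, mul_zero]
    · rw [hf _ h, zero_mul]
  have h4 : Q = 0 := (mul_eq_zero.1 h3).resolve_right (Matrix.charpoly_monic _).ne_zero
  have h5 := hQ 0
  rw [h4, Polynomial.eval_zero, map_zero, add_zero] at h5
  exact h5.symm

end Polarization

/-! ### The highest weight module as the image of a Young symmetrizer -/

section HighestWeight

variable (n : ℕ) (lam : YoungDiagram)

/-- The tensor with `e_i` in the cells of row `i`. -/
def rowVec : ⨂[ℂ] _c : lam.cells, (Fin n → ℂ) :=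
  PiTensorProduct.tprod ℂ fun c => stdVec n (rowOf lam c)

theorem highestWeightVec_eq_op :
    highestWeightVec n lam = op n (antisymmetrizer (colOf lam)) (rowVec n lam) := by
  rw [highestWeightVec, columnPerms, Finset.sum_filter, op_eq_sum, LinearMap.sum_apply]
  refine Fintype.sum_equiv (Equiv.symmEquiv _ _) _ _ fun q => ?_
  change _ = (antisymmetrizer (colOf lam) q.symm • permMap n q.symm) (rowVec n lam)
  rw [antisymmetrizer_symm, antisymmetrizer, LinearMap.smul_apply, rowVec, permMap_tprod, ite_smul,
    zero_smul]
  rfl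

/-- At the basis tensor labelled by rows, only the identity contributes: a column-preserving
permutation that also preserves rows is trivial. -/
theorem highestWeightVec_ne_zero (hn : lam.colLen 0 ≤ n) : highestWeightVec n lam ≠ 0 := by
  intro h
  have hrow : ∀ c : lam.cells, rowOf lam c < n := fun c =>
    (YoungDiagram.mem_iff_lt_colLen.1
      (lam.up_left_mem le_rfl (Nat.zero_le (c : ℕ × ℕ).2) c.2)).trans_le hn
  have h1 := congrArg (fun w => (tensorBasis lam.cells n).repr w fun c => ⟨rowOf lam c, hrow c⟩) h
  simp only [highestWeightVec, map_sum, map_smul, Finsupp.coe_finsetSum, Finset.sum_apply,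
    Finsupp.smul_apply, tensorBasis_repr_tprod, map_zero, Finsupp.zero_apply, smul_eq_mul] at h1
  rw [Finset.sum_eq_single (Equiv.refl _)] at h1
  · simp [stdVec, rowOf] at h1
  · intro q hq hq1
    obtain ⟨c, hc⟩ : ∃ c, rowOf lam (q c) ≠ rowOf lam c := by
      by_contra! h'
      exact hq1 (Equiv.ext fun c => cell_ext (h' c) ((Finset.mem_filter.1 hq).2 c))
    rw [Finset.prod_eq_zero (Finset.mem_univ c), mul_zero]
    exact if_neg fun h => hc h.symm
  · intro h'
    exact absurd (Finset.mem_filter.2 ⟨Finset.mem_univ _, fun _ => rfl⟩) h'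

theorem tensorRep_eq_diagAct (g : GL (Fin n) ℂ) :
    tensorRep n lam g = diagAct lam.cells n (g : Matrix (Fin n) (Fin n) ℂ) := rfl

theorem op_symmetrizer_rowVec :
    op n (symmetrizer (rowOf lam)) (rowVec n lam)
      = (labelCard (rowOf lam) : ℂ) • rowVec n lam := by
  rw [op_eq_sum, LinearMap.sum_apply, labelCard, Finset.cast_card, Finset.sum_smul,
    Finset.sum_filter]
  refine Finset.sum_congr rfl fun p _ => ?_
  rw [LinearMap.smul_apply, symmetrizer]
  split_ifs with h
  · rw [one_smul, one_smul, rowVec, permMap_tprod]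
    simp only [preserves_symm (rowOf lam) h]
  · rw [zero_smul]

/-- The span of the orbit of the row tensor is the image of the row symmetrizer. -/
theorem span_orbit_rowVec (hn : lam.colLen 0 ≤ n) :
    Submodule.span ℂ (Set.range fun g : GL (Fin n) ℂ => tensorRep n lam g (rowVec n lam))
      = LinearMap.range (op n (symmetrizer (rowOf lam))) := by
  apply le_antisymm
  · rw [Submodule.span_le]
    rintro _ ⟨g, rfl⟩
    refine ⟨(labelCard (rowOf lam) : ℂ)⁻¹ • tensorRep n lam g (rowVec n lam), ?_⟩
    rw [map_smul, tensorRep_eq_diagAct, op_diagAct_apply, op_symmetrizer_rowVec, map_smul,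
      inv_smul_smul₀ (labelCard_ne_zero _)]
    rfl
  · rw [LinearMap.range_eq_map, ← PiTensorProduct.span_tprod_eq_top, Submodule.map_span,
      Submodule.span_le]
    rintro _ ⟨_, ⟨v, rfl⟩, rfl⟩
    -- Separate by a functional ψ that kills the orbit. Its multilinear form vanishes on the row
    -- vectors moved by any invertible matrix, by density by any matrix, hence on every family
    -- constant along rows, as columns are arbitrary. Polarization then kills the symmetrized
    -- tensor.
    by_contra hcon
    obtain ⟨ψ, hψ, hle⟩ := Submodule.exists_le_ker_of_notMem hcon
    apply hψ
    set f := ψ.compMultilinearMap (PiTensorProduct.tprod ℂ) with hf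
    have h1 : ∀ X : Matrix (Fin n) (Fin n) ℂ,
        f (fun c => X.mulVec (stdVec n (rowOf lam c))) = 0 := by
      apply multilinear_apply_eq_zero_of_forall_det_ne_zero
      intro X hX
      have := hle (Submodule.subset_span ⟨Matrix.GeneralLinearGroup.mkOfDetNeZero X hX, rfl⟩)
      rw [LinearMap.mem_ker] at this
      change ψ (diagAct lam.cells n X (rowVec n lam)) = 0 at this
      rwa [rowVec, diagAct_tprod] at this
    have h2 : ∀ w : ℕ → Fin n → ℂ, f (fun c => w (rowOf lam c)) = 0 := by
      intro w
      have h3 := h1 (Matrix.of fun i j => w j i)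
      have h4 : (fun c => (Matrix.of fun i j : Fin n => w j i).mulVec (stdVec n (rowOf lam c)))
          = fun c => w (rowOf lam c) := by
        funext c
        have hc : rowOf lam c < n := (YoungDiagram.mem_iff_lt_colLen.1
          (lam.up_left_mem le_rfl (Nat.zero_le (c : ℕ × ℕ).2) c.2)).trans_le hn
        ext i
        rw [Matrix.mulVec, dotProduct, Finset.sum_eq_single ⟨rowOf lam c, hc⟩]
        · simp [stdVec]
        · intro j _ hj
          rw [stdVec, if_neg fun h => hj (Fin.ext h), mul_zero]
        · simp
      rwa [h4] at h3
    have h5 := sum_perm_eq_zero_of_forall_const (rowOf lam) f h2 v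
    rw [op_eq_sum, LinearMap.sum_apply, map_sum, ← h5]
    refine Fintype.sum_equiv (Equiv.symmEquiv _ _) _ _ fun p => ?_
    change _ = if ∀ c, rowOf lam (p.symm c) = rowOf lam c then f (fun c => v (p.symm c)) else 0
    rw [← symmetrizer_symm, symmetrizer, LinearMap.smul_apply, permMap_tprod, ite_smul, one_smul,
      zero_smul, apply_ite ψ, map_zero]
    rfl

/-- The column antisymmetrizer commutes with the group, so it carries the span of the orbit of the
row tensor, which is the image of the row symmetrizer, onto the module. -/
theorem irrepSubmodule_eq_range (hn : lam.colLen 0 ≤ n) :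
    irrepSubmodule n lam = LinearMap.range (op n (youngIdem lam)) := by
  have h1 : irrepSubmodule n lam = (Submodule.span ℂ
      (Set.range fun g : GL (Fin n) ℂ => tensorRep n lam g (rowVec n lam))).map
        (op n (antisymmetrizer (colOf lam))) := by
    rw [Submodule.map_span, ← Set.range_comp, irrepSubmodule]
    congr 2
    funext g
    rw [Function.comp_apply, highestWeightVec_eq_op, tensorRep_eq_diagAct, op_diagAct_apply]
  rw [h1, span_orbit_rowVec n lam hn, ← LinearMap.range_comp, ← op_conv, youngIdem, map_smul,
    LinearMap.range_smul _ _ (inv_ne_zero youngScalar_ne_zero)]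
  rfl

theorem op_youngIdem_ne_zero (hn : lam.colLen 0 ≤ n) : op n (youngIdem lam) ≠ 0 := by
  intro h
  have h1 : highestWeightVec n lam ∈ irrepSubmodule n lam :=
    Submodule.subset_span ⟨1, by simp⟩
  rw [irrepSubmodule_eq_range n lam hn, h, LinearMap.range_zero] at h1
  exact highestWeightVec_ne_zero n lam hn ((Submodule.mem_bot ℂ).1 h1)

end HighestWeight

/-! ### Nested tensor powers -/

section Nested

variable {ι : Type*} [Fintype ι] [DecidableEq ι] (S : ι → Type*) [∀ j, Fintype (S j)]
  [∀ j, DecidableEq (S j)] (n : ℕ)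

/-- A tensor power over a disjoint union is a tensor product of tensor powers. -/
def nestEquiv : (⨂[ℂ] _c : (Σ j, S j), (Fin n → ℂ)) ≃ₗ[ℂ] ⨂[ℂ] j, ⨂[ℂ] _c : S j, (Fin n → ℂ) :=
  (tensorBasis (Σ j, S j) n).equiv (Basis.piTensorProduct fun j => tensorBasis (S j) n)
    (Equiv.piCurry fun _ _ => Fin n)

theorem nestEquiv_tprod (v : (Σ j, S j) → Fin n → ℂ) :
    nestEquiv S n (PiTensorProduct.tprod ℂ v)
      = PiTensorProduct.tprod ℂ fun j => PiTensorProduct.tprod ℂ fun c => v ⟨j, c⟩ := by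
  let F : (⨂[ℂ] _c : (Σ j, S j), (Fin n → ℂ)) →ₗ[ℂ] ⨂[ℂ] j, ⨂[ℂ] _c : S j, (Fin n → ℂ) :=
    PiTensorProduct.lift (MultilinearMap.compMultilinearMap (PiTensorProduct.tprod ℂ)
      fun j => PiTensorProduct.tprod ℂ (s := fun _ : S j => Fin n → ℂ))
  have h1 : (nestEquiv S n).toLinearMap = F := by
    refine (tensorBasis (Σ j, S j) n).ext fun φ => ?_
    rw [LinearEquiv.coe_coe, nestEquiv, Module.Basis.equiv_apply, Basis.piTensorProduct_apply,
      tensorBasis_apply, PiTensorProduct.lift.tprod]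
    simp only [tensorBasis_apply]
    rfl
  calc nestEquiv S n (PiTensorProduct.tprod ℂ v) = F (PiTensorProduct.tprod ℂ v) := by
        rw [← h1]; rfl
    _ = _ := by
        rw [PiTensorProduct.lift.tprod]
        rfl

theorem nestEquiv_op_box (y : ∀ j, (S j ≃ S j) → ℂ) (w : ⨂[ℂ] _c : (Σ j, S j), (Fin n → ℂ)) :
    nestEquiv S n (op n (box y) w) = PiTensorProduct.map (fun j => op n (y j)) (nestEquiv S n w) := by
  suffices h : (nestEquiv S n).toLinearMap ∘ₗ op n (box y)
      = PiTensorProduct.map (fun j => op n (y j)) ∘ₗ (nestEquiv S n).toLinearMap from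
    congrArg (fun F => F w) h
  refine PiTensorProduct.ext (MultilinearMap.ext fun v => ?_)
  simp only [LinearMap.compMultilinearMap_apply, LinearMap.comp_apply, LinearEquiv.coe_coe,
    nestEquiv_tprod, PiTensorProduct.map_tprod, box, map_sum, map_smul, LinearMap.sum_apply,
    LinearMap.smul_apply, op_delta, permMap_tprod]
  simp only [op_eq_sum, LinearMap.sum_apply, LinearMap.smul_apply, permMap_tprod]
  rw [MultilinearMap.map_sum]
  refine Finset.sum_congr rfl fun h _ => ?_
  rw [MultilinearMap.map_smul_univ]
  rfl

theorem nestEquiv_diagAct (X : Matrix (Fin n) (Fin n) ℂ) (w : ⨂[ℂ] _c : (Σ j, S j), (Fin n → ℂ)) :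
    nestEquiv S n (diagAct _ n X w)
      = PiTensorProduct.map (fun j => diagAct (S j) n X) (nestEquiv S n w) := by
  suffices h : (nestEquiv S n).toLinearMap ∘ₗ diagAct _ n X
      = PiTensorProduct.map (fun j => diagAct (S j) n X) ∘ₗ (nestEquiv S n).toLinearMap from
    congrArg (fun F => F w) h
  refine PiTensorProduct.ext (MultilinearMap.ext fun v => ?_)
  simp only [LinearMap.compMultilinearMap_apply, LinearMap.comp_apply, LinearEquiv.coe_coe,
    nestEquiv_tprod, PiTensorProduct.map_tprod, diagAct_tprod]

end Nested

/-! ### Equivariant maps -/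

section Weights

variable (n : ℕ) {lam : YoungDiagram} {D : Type*} [Fintype D] [DecidableEq D]

theorem diagAct_diagonal_tensorBasis (t : Fin n → ℂ) (φ : D → Fin n) :
    diagAct D n (Matrix.diagonal t) (tensorBasis D n φ) = (∏ c, t (φ c)) • tensorBasis D n φ := by
  rw [tensorBasis_apply, diagAct_tprod, ← MultilinearMap.map_smul_univ]
  congr 1
  funext c
  ext k
  rw [Matrix.mulVec_diagonal, Pi.smul_apply, smul_eq_mul, stdVec]
  split_ifs with h
  · rw [Fin.ext h]
  · simp

theorem rowVec_eq_tensorBasis (hrow : ∀ c : lam.cells, rowOf lam c < n) :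
    rowVec n lam = tensorBasis lam.cells n fun c => ⟨rowOf lam c, hrow c⟩ := by
  rw [tensorBasis_apply]; rfl

theorem rowOf_lt (hn : lam.colLen 0 ≤ n) (c : lam.cells) : rowOf lam c < n :=
  (YoungDiagram.mem_iff_lt_colLen.1
    (lam.up_left_mem le_rfl (Nat.zero_le (c : ℕ × ℕ).2) c.2)).trans_le hn

/-- Two labellings with the same multiplicities differ by a bijection. -/
theorem exists_equiv_of_card_fiber_eq {A B L : Type*} [Fintype A] [Fintype B] [DecidableEq L]
    (f : A → L) (g : B → L) (h : ∀ i, Fintype.card {a // f a = i} = Fintype.card {b // g b = i}) :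
    ∃ τ : A ≃ B, ∀ b, f (τ.symm b) = g b := by
  let τ : A ≃ B := (Equiv.sigmaFiberEquiv f).symm.trans ((Equiv.sigmaCongrRight fun i =>
    Fintype.equivOfCardEq (h i)).trans (Equiv.sigmaFiberEquiv g))
  have h1 : ∀ a, g (τ a) = f a := fun a => (Fintype.equivOfCardEq (h (f a)) ⟨a, rfl⟩).2
  exact ⟨τ, fun b => by rw [← h1, Equiv.apply_symm_apply]⟩

/-- A vector of weight `lam` in a tensor power is obtained from the row tensor by bijections. -/
theorem exists_op_rowVec (hn : lam.colLen 0 ≤ n) (w : ⨂[ℂ] _c : D, (Fin n → ℂ))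
    (hw : ∀ t : Fin n → ℂ, (∀ i, t i ≠ 0) → diagAct D n (Matrix.diagonal t) w
      = (∏ c : lam.cells, t ⟨rowOf lam c, rowOf_lt n hn c⟩) • w) :
    ∃ y : (lam.cells ≃ D) → ℂ, w = op n y (rowVec n lam) := by
  have hmem : w ∈ LinearMap.range ((op (S := lam.cells) (T := D) n).flip (rowVec n lam)) := by
    rw [← (tensorBasis D n).sum_repr w]
    refine Submodule.sum_mem _ fun φ _ => ?_
    by_cases h0 : (tensorBasis D n).repr w φ = 0
    · rw [h0, zero_smul]
      exact Submodule.zero_mem _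
    · refine Submodule.smul_mem _ _ ?_
      have h1 : ∀ t : Fin n → ℂ, (∀ i, t i ≠ 0) →
          ∏ c, t (φ c) = ∏ c : lam.cells, t ⟨rowOf lam c, rowOf_lt n hn c⟩ := by
        intro t ht
        have h2 := congrArg (fun w => (tensorBasis D n).repr w φ) (hw t ht)
        simp only [map_smul, Finsupp.smul_apply, smul_eq_mul] at h2
        conv_lhs at h2 => rw [← (tensorBasis D n).sum_repr w]
        simp only [map_sum, map_smul, diagAct_diagonal_tensorBasis, Module.Basis.repr_self,
          Finsupp.coe_finsetSum, Finset.sum_apply, Finsupp.smul_apply, smul_eq_mul,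
          Finsupp.single_apply, mul_ite, mul_one, mul_zero, Finset.sum_ite_eq',
          Finset.mem_univ, if_true] at h2
        exact mul_left_cancel₀ h0 (h2.trans (mul_comm _ _))
      obtain ⟨τ, hτ⟩ := exists_equiv_of_card_fiber_eq
        (fun c : lam.cells => (⟨rowOf lam c, rowOf_lt n hn c⟩ : Fin n)) φ fun i => by
          -- Evaluating both weights at 2 in position i and 1 elsewhere turns equal weights into
          -- equal multiplicities of the label i.
          have h3 := h1 (fun j => if j = i then 2 else 1) fun j => by split_ifs <;> norm_num
          simp only [Finset.prod_ite, Finset.prod_const, one_pow, mul_one] at h3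
          rw [Fintype.card_subtype, Fintype.card_subtype]
          have h4 : (2 : ℕ) ^ (Finset.univ.filter fun c => φ c = i).card
              = 2 ^ (Finset.univ.filter fun c : lam.cells =>
                (⟨rowOf lam c, rowOf_lt n hn c⟩ : Fin n) = i).card := by
            exact_mod_cast h3
          exact (Nat.pow_right_injective le_rfl h4).symm
      refine ⟨delta τ, ?_⟩
      rw [LinearMap.flip_apply, op_delta, rowVec, permMap_tprod, tensorBasis_apply]
      congr 1
      funext c
      rw [← hτ]
  obtain ⟨y, hy⟩ := hmem
  exact ⟨y, hy.symm⟩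

/-- Equivariant maps out of the image of a Young symmetrizer are linear combinations of
bijections. -/
theorem exists_op_of_equivariant (hn : lam.colLen 0 ≤ n)
    (F : (⨂[ℂ] _c : lam.cells, (Fin n → ℂ)) →ₗ[ℂ] (⨂[ℂ] _c : D, (Fin n → ℂ)))
    (hF : ∀ g : GL (Fin n) ℂ, F ∘ₗ diagAct lam.cells n (g : Matrix (Fin n) (Fin n) ℂ)
      = diagAct D n (g : Matrix (Fin n) (Fin n) ℂ) ∘ₗ F)
    (he : F ∘ₗ op n (youngIdem lam) = F) :
    ∃ y : (lam.cells ≃ D) → ℂ, F = op n y := by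
  have hF' : ∀ (g : GL (Fin n) ℂ) w, F (diagAct lam.cells n (g : Matrix (Fin n) (Fin n) ℂ) w)
      = diagAct D n (g : Matrix (Fin n) (Fin n) ℂ) (F w) :=
    fun g w => congrArg (fun H => H w) (hF g)
  -- F maps the highest weight vector to a vector of weight λ, which is therefore y applied to the
  -- row tensor.
  obtain ⟨y, hy⟩ := exists_op_rowVec n hn
    (F (op n (antisymmetrizer (colOf lam)) (rowVec n lam))) fun t ht => by
      have hdet : (Matrix.diagonal t).det ≠ 0 := by
        rw [Matrix.det_diagonal]
        exact Finset.prod_ne_zero_iff.2 fun i _ => ht i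
      have h1 := hF' (Matrix.GeneralLinearGroup.mkOfDetNeZero _ hdet)
        (op n (antisymmetrizer (colOf lam)) (rowVec n lam))
      have h2 : ((Matrix.GeneralLinearGroup.mkOfDetNeZero _ hdet : GL (Fin n) ℂ) :
        Matrix (Fin n) (Fin n) ℂ) = Matrix.diagonal t := rfl
      rw [h2] at h1
      rw [← h1, ← op_diagAct_apply, rowVec_eq_tensorBasis n (rowOf_lt n hn),
        diagAct_diagonal_tensorBasis, map_smul, map_smul]
  -- F b and y are both equivariant and agree on the row tensor, hence on the span of its orbit. As
  -- F = F e_λ is a multiple of F b a, it is a multiple of y a.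
  have h3 : ∀ w ∈ LinearMap.range (op n (symmetrizer (rowOf lam))),
      F (op n (antisymmetrizer (colOf lam)) w) = op n y w := by
    rw [← span_orbit_rowVec n lam hn]
    intro w hw
    induction hw using Submodule.span_induction with
    | mem w hw =>
      obtain ⟨g, rfl⟩ := hw
      change F (op n _ (diagAct _ n _ _)) = op n y (diagAct _ n _ _)
      rw [op_diagAct_apply, op_diagAct_apply, hF', hy]
    | zero => simp
    | add w w' _ _ h h' => rw [map_add, map_add, map_add, h, h']
    | smul a w _ h => rw [map_smul, map_smul, map_smul, h]
  refine ⟨(youngScalar lam)⁻¹ • conv y (symmetrizer (rowOf lam)), ?_⟩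
  rw [← he]
  refine LinearMap.ext fun w => ?_
  rw [LinearMap.comp_apply, youngIdem, map_smul, map_smul, LinearMap.smul_apply,
    LinearMap.smul_apply, map_smul, youngSym, op_conv_apply, op_conv_apply,
    h3 _ (LinearMap.mem_range_self _ w)]

/-- A nonzero y = y e_λ satisfies z y = e_λ for some z, and e_λ acts nontrivially. Thus the action
is faithful on this block even when n is smaller than the number of cells. -/
theorem op_injOn (hn : lam.colLen 0 ≤ n) {y : (lam.cells ≃ D) → ℂ}
    (hy : conv y (youngIdem lam) = y) (h : op n y = 0) : y = 0 := by
  by_contra h0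
  obtain ⟨z, hz⟩ := exists_conv_eq_youngIdem hy h0
  refine op_youngIdem_ne_zero n lam hn ?_
  rw [← hz, op_conv, h, LinearMap.comp_zero]

end Weights

/-! ### Multiplicities as traces of idempotents -/

section Multiplicity

variable (n : ℕ) {m : ℕ} (lam : YoungDiagram) (mu : Fin m → YoungDiagram)

variable {lam} in
/-- The projection onto the irreducible representation. -/
def irrepProj (hn : lam.colLen 0 ≤ n) :
    (⨂[ℂ] _c : lam.cells, (Fin n → ℂ)) →ₗ[ℂ] irrepSubmodule n lam :=
  (op n (youngIdem lam)).codRestrict _ fun w => by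
    rw [irrepSubmodule_eq_range n lam hn]; exact LinearMap.mem_range_self _ w

theorem irrepProj_apply_coe (hn : lam.colLen 0 ≤ n) (w : irrepSubmodule n lam) :
    irrepProj n hn w = w := by
  obtain ⟨v, hv⟩ := (irrepSubmodule_eq_range n lam hn).le w.2
  refine Subtype.ext ?_
  change op n (youngIdem lam) w = w
  rw [← hv, ← op_conv_apply, youngIdem_conv_self]

theorem irrepProj_op (hn : lam.colLen 0 ≤ n) (w : ⨂[ℂ] _c : lam.cells, (Fin n → ℂ)) :
    irrepProj n hn (op n (youngIdem lam) w) = irrepProj n hn w := by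
  refine Subtype.ext ?_
  change op n (youngIdem lam) (op n (youngIdem lam) w) = op n (youngIdem lam) w
  rw [← op_conv_apply, youngIdem_conv_self]

theorem irrepProj_diagAct (hn : lam.colLen 0 ≤ n) (g : GL (Fin n) ℂ)
    (w : ⨂[ℂ] _c : lam.cells, (Fin n → ℂ)) :
    irrepProj n hn (diagAct lam.cells n (g : Matrix (Fin n) (Fin n) ℂ) w)
      = irrep n lam g (irrepProj n hn w) :=
  Subtype.ext (op_diagAct_apply n _ _ w)

/-- The inclusion of a tensor product of irreducible representations into a tensor power. -/
def tupleIncl : (⨂[ℂ] j, irrepSubmodule n (mu j)) →ₗ[ℂ]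
    (⨂[ℂ] _c : (Σ j, (mu j).cells), (Fin n → ℂ)) :=
  (nestEquiv (fun j => (mu j).cells) n).symm.toLinearMap ∘ₗ
    PiTensorProduct.map fun j => (irrepSubmodule n (mu j)).subtype

variable {mu} in
/-- The projection of a tensor power onto a tensor product of irreducible representations. -/
def tupleProj (hmu : ∀ j, (mu j).colLen 0 ≤ n) :
    (⨂[ℂ] _c : (Σ j, (mu j).cells), (Fin n → ℂ)) →ₗ[ℂ] (⨂[ℂ] j, irrepSubmodule n (mu j)) :=
  (PiTensorProduct.map fun j => irrepProj n (hmu j)) ∘ₗ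
    (nestEquiv (fun j => (mu j).cells) n).toLinearMap

theorem tupleProj_comp_tupleIncl (hmu : ∀ j, (mu j).colLen 0 ≤ n) :
    tupleProj n hmu ∘ₗ tupleIncl n mu = LinearMap.id := by
  refine LinearMap.ext fun w => ?_
  simp only [tupleProj, tupleIncl, LinearMap.comp_apply, LinearEquiv.coe_coe,
    LinearEquiv.apply_symm_apply]
  rw [← LinearMap.comp_apply, ← PiTensorProduct.map_comp]
  have : (fun j => irrepProj n (hmu j) ∘ₗ (irrepSubmodule n (mu j)).subtype)
      = fun j => LinearMap.id := by
    funext j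
    exact LinearMap.ext fun w => irrepProj_apply_coe n (mu j) (hmu j) w
  rw [this, PiTensorProduct.map_id]

theorem tupleIncl_comp_tupleProj (hmu : ∀ j, (mu j).colLen 0 ≤ n) :
    tupleIncl n mu ∘ₗ tupleProj n hmu = op n (tupleIdem mu) := by
  refine LinearMap.ext fun w => ?_
  simp only [tupleProj, tupleIncl, LinearMap.comp_apply, LinearEquiv.coe_coe]
  rw [LinearEquiv.symm_apply_eq, tupleIdem, nestEquiv_op_box, ← LinearMap.comp_apply,
    ← PiTensorProduct.map_comp]
  rfl

theorem tupleIncl_piTensor (g : GL (Fin n) ℂ) (w : ⨂[ℂ] j, irrepSubmodule n (mu j)) :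
    tupleIncl n mu (piTensor (fun j => irrep n (mu j)) g w)
      = diagAct _ n (g : Matrix (Fin n) (Fin n) ℂ) (tupleIncl n mu w) := by
  simp only [tupleIncl, LinearMap.comp_apply, LinearEquiv.coe_coe]
  rw [LinearEquiv.symm_apply_eq, nestEquiv_diagAct, LinearEquiv.apply_symm_apply]
  have h1 : PiTensorProduct.map (fun j => (irrepSubmodule n (mu j)).subtype) ∘ₗ
      PiTensorProduct.map (fun j => irrep n (mu j) g)
      = PiTensorProduct.map (fun j => diagAct (mu j).cells n (g : Matrix (Fin n) (Fin n) ℂ)) ∘ₗ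
        PiTensorProduct.map (fun j => (irrepSubmodule n (mu j)).subtype) := by
    rw [← PiTensorProduct.map_comp, ← PiTensorProduct.map_comp]
    rfl
  exact congrArg (fun F => F w) h1

theorem tupleProj_diagAct (hmu : ∀ j, (mu j).colLen 0 ≤ n) (g : GL (Fin n) ℂ)
    (w : ⨂[ℂ] _c : (Σ j, (mu j).cells), (Fin n → ℂ)) :
    tupleProj n hmu (diagAct _ n (g : Matrix (Fin n) (Fin n) ℂ) w)
      = piTensor (fun j => irrep n (mu j)) g (tupleProj n hmu w) := by
  simp only [tupleProj, LinearMap.comp_apply, LinearEquiv.coe_coe]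
  rw [nestEquiv_diagAct]
  change _ = PiTensorProduct.map _ (PiTensorProduct.map _ _)
  rw [← LinearMap.comp_apply (PiTensorProduct.map _), ← PiTensorProduct.map_comp,
    ← LinearMap.comp_apply (PiTensorProduct.map _), ← PiTensorProduct.map_comp]
  congr 2
  funext j
  exact LinearMap.ext fun w => irrepProj_diagAct n (mu j) (hmu j) g w

variable {mu} in
/-- The equivariant map given by a linear combination of bijections. -/
def toIntertwining (hmu : ∀ j, (mu j).colLen 0 ≤ n) :
    ((lam.cells ≃ (Σ j, (mu j).cells)) → ℂ) →ₗ[ℂ]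
      Representation.IntertwiningMap (irrep n lam) (piTensor fun j => irrep n (mu j)) where
  toFun y := ⟨tupleProj n hmu ∘ₗ op n y ∘ₗ (irrepSubmodule n lam).subtype, fun g => by
    refine LinearMap.ext fun w => ?_
    change tupleProj n hmu (op n y (diagAct _ n _ (w : ⨂[ℂ] _c : lam.cells, (Fin n → ℂ)))) = _
    rw [op_diagAct_apply, tupleProj_diagAct]
    rfl⟩
  map_add' y z := by
    refine Representation.IntertwiningMap.ext ?_
    refine LinearMap.ext fun w => ?_
    simp
  map_smul' a y := by
    refine Representation.IntertwiningMap.ext ?_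
    refine LinearMap.ext fun w => ?_
    simp

theorem toIntertwining_apply (hmu : ∀ j, (mu j).colLen 0 ≤ n)
    (y : (lam.cells ≃ (Σ j, (mu j).cells)) → ℂ) (w : irrepSubmodule n lam) :
    toIntertwining n lam hmu y w = tupleProj n hmu (op n y w) := rfl

/-- Injectivity is faithfulness on the λ block. For surjectivity, extend an equivariant map to the
tensor powers by the projection and the inclusion; the extension is a combination y of bijections,
and e_μ y e_λ induces the same map. -/
theorem toIntertwining_bijective (hlam : lam.colLen 0 ≤ n) (hmu : ∀ j, (mu j).colLen 0 ≤ n) :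
    Function.Bijective ((toIntertwining n lam hmu).domRestrict
      (LinearMap.range (sandwich (tupleIdem mu) (youngIdem lam)))) := by
  constructor
  · rw [injective_iff_map_eq_zero]
    rintro ⟨y, z, rfl⟩ hy
    have hidem := sandwich_idem (tupleIdem_conv_self mu) (youngIdem_conv_self (lam := lam)) z
    set y := sandwich (tupleIdem mu) (youngIdem lam) z with hy'
    refine Subtype.ext (op_injOn n hlam (y := y) ?_ (LinearMap.ext fun w => ?_))
    · rw [hy', sandwich_apply, conv_assoc, conv_assoc, youngIdem_conv_self]
    · have h0 : toIntertwining n lam hmu y = 0 := hy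
      have h1 : tupleProj n hmu (op n y (irrepProj n hlam w)) = 0 := by
        rw [← toIntertwining_apply, h0]
        rfl
      have hz : ∀ v, tupleProj n hmu v = 0 → op n (tupleIdem mu) v = 0 := fun v hv => by
        rw [← tupleIncl_comp_tupleProj n mu hmu, LinearMap.comp_apply, hv, map_zero]
      have h2 : op n (tupleIdem mu) (op n y (op n (youngIdem lam) w)) = 0 := hz _ h1
      rw [← op_conv_apply, ← op_conv_apply, conv_assoc, ← sandwich_apply, hidem] at h2
      exact h2
  · intro T
    obtain ⟨y, hy⟩ := exists_op_of_equivariant n hlam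
      (tupleIncl n mu ∘ₗ T.toLinearMap ∘ₗ irrepProj n hlam) (fun g => LinearMap.ext fun w => by
        simp only [LinearMap.comp_apply]
        rw [irrepProj_diagAct, ← tupleIncl_piTensor]
        exact congrArg _ (T.isIntertwining _ _ g _))
      (LinearMap.ext fun w => by
        simp only [LinearMap.comp_apply]
        rw [irrepProj_op])
    refine ⟨⟨sandwich (tupleIdem mu) (youngIdem lam) y, LinearMap.mem_range_self _ y⟩, ?_⟩
    refine Representation.IntertwiningMap.ext (LinearMap.ext fun w => ?_)
    change tupleProj n hmu (op n (sandwich (tupleIdem mu) (youngIdem lam) y) w) = T w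
    have h1 : op n (youngIdem lam) (w : ⨂[ℂ] _c : lam.cells, (Fin n → ℂ)) = w :=
      congrArg Subtype.val (irrepProj_apply_coe n lam hlam w)
    rw [sandwich_apply, op_conv_apply, op_conv_apply, h1, ← hy, ← tupleIncl_comp_tupleProj n mu hmu]
    simp only [LinearMap.comp_apply]
    rw [irrepProj_apply_coe]
    have h2 : ∀ x, tupleProj n hmu (tupleIncl n mu x) = x := fun x =>
      congrArg (fun F => F x) (tupleProj_comp_tupleIncl n mu hmu)
    rw [h2, h2]
    rfl

/-- The right side does not involve n, so the multiplicity is the same for all admissible n. -/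
theorem lrCoeff_eq_traceMult (hlam : lam.colLen 0 ≤ n) (hmu : ∀ j, (mu j).colLen 0 ≤ n) :
    (lrCoeff n lam mu : ℂ) = traceMult lam mu := by
  rw [traceMult, ← finrank_range_sandwich (tupleIdem_conv_self mu) youngIdem_conv_self, lrCoeff]
  rw [(LinearEquiv.ofBijective _ (toIntertwining_bijective n lam mu hlam hmu)).finrank_eq]

end Multiplicity

/-! ### Counting necklaces -/

section Necklaces

/-- Words of length `k`, with letters indexed cyclically. -/
def CyclicWord (k m : ℕ) : Type := ZMod k → Fin m

variable {k m : ℕ}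

instance [NeZero k] : Fintype (CyclicWord k m) := inferInstanceAs (Fintype (ZMod k → Fin m))

instance : AddAction (ZMod k) (CyclicWord k m) where
  vadd a f := fun i => f (i + a)
  zero_vadd f := funext fun i => congrArg f (add_zero i)
  add_vadd a b f := funext fun i => congrArg f (by ring)

theorem vadd_cyclicWord_apply (a : ZMod k) (f : CyclicWord k m) (i : ZMod k) :
    (a +ᵥ f) i = f (i + a) := rfl

/-- Words fixed by the rotation by `a` are the functions on the quotient by the subgroup generated
by `a`. -/
def fixedByEquiv (a : ZMod k) :
    AddAction.fixedBy (CyclicWord k m) a ≃ ((ZMod k ⧸ AddSubgroup.zmultiples a) → Fin m) where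
  toFun f := fun q => Quotient.liftOn' q f.1 (by
    intro x y h
    rw [QuotientAddGroup.leftRel_apply, AddSubgroup.mem_zmultiples_iff] at h
    obtain ⟨t, ht⟩ := h
    have hf : ∀ t : ℤ, (t • a) +ᵥ f.1 = f.1 := fun t => by
      have h1 : a ∈ AddAction.stabilizer (ZMod k) f.1 := f.2
      exact (AddAction.stabilizer (ZMod k) f.1).zsmul_mem h1 t
    have h2 := congrFun (hf t) x
    rw [vadd_cyclicWord_apply, ht] at h2
    rw [← h2]
    exact congrArg f.1 (by abel))
  invFun g := ⟨fun i => g (i : ZMod k ⧸ AddSubgroup.zmultiples a), funext fun i => by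
    change g ((i + a : ZMod k) : ZMod k ⧸ AddSubgroup.zmultiples a) = g i
    refine congrArg g ?_
    rw [QuotientAddGroup.eq]
    refine AddSubgroup.mem_zmultiples_iff.2 ⟨-1, ?_⟩
    simp⟩
  left_inv f := rfl
  right_inv g := funext fun q => Quotient.inductionOn' q fun _ => rfl

theorem card_fixedBy_cyclicWord [NeZero k] (a : ZMod k) :
    Nat.card (AddAction.fixedBy (CyclicWord k m) a) = m ^ (k / addOrderOf a) := by
  rw [Nat.card_congr (fixedByEquiv a), Nat.card_fun]
  congr 1
  · simp
  · have h := AddSubgroup.card_eq_card_quotient_mul_card_addSubgroup (AddSubgroup.zmultiples a)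
    rw [Nat.card_zmultiples, Nat.card_zmod] at h
    exact (Nat.div_eq_of_eq_mul_left (addOrderOf_pos a) h).symm

theorem sum_pow_addOrderOf [NeZero k] :
    ∑ a : ZMod k, m ^ (k / addOrderOf a) = ∑ r ∈ k.divisors, r.totient * m ^ (k / r) := by
  classical
  have hmaps : ∀ a ∈ (Finset.univ : Finset (ZMod k)), addOrderOf a ∈ k.divisors := fun a _ =>
    Nat.mem_divisors.2 ⟨by simpa using addOrderOf_dvd_card (x := a), NeZero.ne k⟩
  rw [← Finset.sum_fiberwise_of_maps_to hmaps]
  refine Finset.sum_congr rfl fun r hr => ?_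
  rw [Finset.sum_congr rfl (fun a ha => by rw [(Finset.mem_filter.1 ha).2]), Finset.sum_const,
    smul_eq_mul, IsAddCyclic.card_addOrderOf_eq_totient (by simpa using Nat.dvd_of_mem_divisors hr)]

/-- Burnside's lemma: rotation by a fixes m^(k / ord a) words, and φ(r) rotations have order r. -/
theorem card_orbits_mul [NeZero k] :
    Nat.card (AddAction.orbitRel.Quotient (ZMod k) (CyclicWord k m)) * k
      = ∑ r ∈ k.divisors, r.totient * m ^ (k / r) := by
  classical
  have : Finite (AddAction.orbitRel.Quotient (ZMod k) (CyclicWord k m)) := Quotient.finite _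
  let := Fintype.ofFinite (AddAction.orbitRel.Quotient (ZMod k) (CyclicWord k m))
  let : ∀ a : ZMod k, Fintype (AddAction.fixedBy (CyclicWord k m) a) :=
    fun a => Fintype.ofFinite _
  have h := AddAction.sum_card_fixedBy_eq_card_orbits_mul_card_addGroup (ZMod k) (CyclicWord k m)
  rw [ZMod.card, ← Nat.card_eq_fintype_card] at h
  rw [← sum_pow_addOrderOf]
  refine h.symm.trans (Finset.sum_congr rfl fun a _ => ?_)
  rw [← Nat.card_eq_fintype_card, card_fixedBy_cyclicWord]

/-- The letters of a word, in order. -/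
def CyclicWord.toList {k m : ℕ} (f : CyclicWord (k + 1) m) : List (Fin m) :=
  -- `ZMod (k + 1)` is `Fin (k + 1)` by definition, which is why lengths are written as successors.
  List.ofFn (n := k + 1) f

theorem CyclicWord.length_toList {k m : ℕ} (f : CyclicWord (k + 1) m) :
    f.toList.length = k + 1 := List.length_ofFn

theorem CyclicWord.toList_rotate {k m : ℕ} (f : CyclicWord (k + 1) m) (t : ℕ) :
    f.toList.rotate t = CyclicWord.toList ((t : ZMod (k + 1)) +ᵥ f) := by
  refine List.ext_getElem (by simp [length_toList]) fun i h1 h2 => ?_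
  rw [List.getElem_rotate]
  refine (List.getElem_ofFn _).trans (Eq.trans ?_ (List.getElem_ofFn h2).symm)
  refine congrArg f (Fin.ext ?_)
  change (i + t) % f.toList.length = (i + ZMod.val (t : ZMod (k + 1))) % (k + 1)
  rw [length_toList, ZMod.val_natCast, Nat.add_mod_mod]

theorem CyclicWord.toList_injective {k m : ℕ} :
    Function.Injective (CyclicWord.toList (k := k) (m := m)) := List.ofFn_injective

/-- Words up to cyclic shifts are cycles. -/
def orbitsEquivCycles (k m : ℕ) :
    AddAction.orbitRel.Quotient (ZMod (k + 1)) (CyclicWord (k + 1) m)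
      ≃ {c : Cycle (Fin m) // c.length = k + 1} := by
  refine Equiv.ofBijective (fun q => Quotient.liftOn' q
    (fun f => ⟨(f.toList : Cycle (Fin m)), f.length_toList⟩) ?_) ⟨?_, ?_⟩
  · rintro f g ⟨a, rfl⟩
    refine Subtype.ext (Cycle.coe_eq_coe.2 (List.IsRotated.symm ⟨ZMod.val a, ?_⟩))
    rw [CyclicWord.toList_rotate, ZMod.natCast_zmod_val]
  · intro p q
    refine Quotient.inductionOn₂' p q fun f g h => ?_
    obtain ⟨t, ht⟩ := Cycle.coe_eq_coe.1 (Subtype.ext_iff.1 h)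
    rw [CyclicWord.toList_rotate] at ht
    exact Quotient.sound' (AddAction.orbitRel_apply.2
      (AddAction.mem_orbit_symm.1 ⟨_, CyclicWord.toList_injective ht⟩))
  · rintro ⟨c, hc⟩
    obtain ⟨l, rfl⟩ := Quotient.exists_rep c
    have hl : l.length = k + 1 := hc
    refine ⟨Quotient.mk'' (fun i : Fin (k + 1) => l.get (i.cast hl.symm)), Subtype.ext ?_⟩
    refine congrArg (fun l : List (Fin m) => (l : Cycle (Fin m)))
      (List.ext_getElem (List.length_ofFn.trans hl.symm) fun i h1 h2 => ?_)
    exact List.getElem_ofFn h1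

theorem card_cycles_mul (k m : ℕ) :
    Nat.card {c : Cycle (Fin m) // c.length = k + 1} * (k + 1)
      = ∑ r ∈ (k + 1).divisors, r.totient * m ^ ((k + 1) / r) := by
  rw [← card_orbits_mul, Nat.card_congr (orbitsEquivCycles k m)]

theorem card_cycles (k m : ℕ) :
    Nat.card {c : Cycle (Fin m) // c.length = k + 1} = necklaceCount (k + 1) m := by
  rw [necklaceCount, ← card_cycles_mul, Nat.mul_div_cancel _ k.succ_pos]

theorem finite_cycles (k m : ℕ) : {c : Cycle (Fin m) | c.length = k + 1}.Finite :=
  have : Finite (AddAction.orbitRel.Quotient (ZMod (k + 1)) (CyclicWord (k + 1) m)) :=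
    Quotient.finite _
  Finite.of_equiv _ (orbitsEquivCycles k m)

/-- The orbit count shows that the natural number division in `necklaceCount` is exact. -/
theorem necklaceCount_mul (k m : ℕ) :
    necklaceCount (k + 1) m * (k + 1) = ∑ r ∈ (k + 1).divisors, r.totient * m ^ ((k + 1) / r) := by
  rw [← card_cycles, card_cycles_mul]

theorem necklaceCount_eq_rat (k m : ℕ) : (necklaceCount (k + 1) m : ℚ)
    = (1 / (k + 1 : ℕ)) * ∑ r ∈ (k + 1).divisors, (r.totient : ℚ) * (m : ℚ) ^ ((k + 1) / r) := by
  have h := congrArg (Nat.cast (R := ℚ)) (necklaceCount_mul k m)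
  push_cast at h ⊢
  rw [← h]
  field_simp

/-- Associativity of Dirichlet convolution: ζ * (φ * P) = (ζ * φ) * P = id * P with P k = m^k. -/
theorem sum_divisors_necklaceCount (n m : ℕ) :
    ∑ k ∈ n.divisors, k * necklaceCount k m = ∑ k ∈ n.divisors, k * m ^ (n / k) := by
  rcases Nat.eq_zero_or_pos n with rfl | hn
  · simp
  -- The value 0 at 0 is forced on an arithmetic function; quotients by divisors are positive, so it
  -- is never used.
  let P : ArithmeticFunction ℕ := ⟨fun k => if k = 0 then 0 else m ^ k, by simp⟩
  let F : ArithmeticFunction ℕ := ⟨Nat.totient, Nat.totient_zero⟩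
  have hconv : ∀ (f : ArithmeticFunction ℕ) (k : ℕ),
      (f * P) k = ∑ r ∈ k.divisors, f r * m ^ (k / r) := fun f k => by
    rw [ArithmeticFunction.mul_apply, Nat.sum_divisorsAntidiagonal (fun r s => f r * P s)]
    refine Finset.sum_congr rfl fun r hr => ?_
    have h : k / r ≠ 0 := (Nat.div_pos (Nat.divisor_le hr) (Nat.pos_of_mem_divisors hr)).ne'
    exact congrArg _ (if_neg h)
  have hF : ArithmeticFunction.zeta * F = ArithmeticFunction.id := by
    ext k
    rw [ArithmeticFunction.zeta_mul_apply]
    exact Nat.sum_totient k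
  have h := congrArg (fun f => f n) (mul_assoc ArithmeticFunction.zeta F P)
  simp only [hF] at h
  rw [ArithmeticFunction.zeta_mul_apply, hconv] at h
  simp only [ArithmeticFunction.id_apply] at h
  rw [h]
  refine Finset.sum_congr rfl fun k hk => ?_
  obtain ⟨k, rfl⟩ := Nat.exists_eq_succ_of_ne_zero (Nat.pos_of_mem_divisors hk).ne'
  rw [hconv, mul_comm]
  exact necklaceCount_mul k m

end Necklaces

/-! ### Products of geometric series -/

section GeometricSeries

open PowerSeries

/-- The expansion of `1 / (1 - c t^k)`. -/
def geom (c : ℤ) (k : ℕ) : ℤ⟦X⟧ := mk fun j => if k ∣ j then c ^ (j / k) else 0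

theorem coeff_geom (c : ℤ) (k j : ℕ) :
    coeff j (geom c k) = if k ∣ j then c ^ (j / k) else 0 := coeff_mk _ _

variable {k : ℕ}

theorem geom_eq (c : ℤ) (hk : 0 < k) : geom c k = 1 + X ^ k * (C c * geom c k) := by
  ext j
  rw [map_add, coeff_X_pow_mul', coeff_C_mul, coeff_geom, coeff_geom, coeff_one]
  rcases Nat.lt_or_ge j k with hj | hj
  · rw [if_neg (Nat.not_le.2 hj), add_zero]
    rcases Nat.eq_zero_or_pos j with rfl | h0
    · simp
    · rw [if_neg (fun h => (Nat.le_of_dvd h0 h).not_gt hj), if_neg h0.ne']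
  · obtain ⟨i, rfl⟩ := Nat.exists_eq_add_of_le hj
    rw [if_pos hj, Nat.add_sub_cancel_left, if_neg (show k + i ≠ 0 by omega), zero_add,
      Nat.add_div_left _ hk, pow_succ]
    have h : k ∣ k + i ↔ k ∣ i := Nat.dvd_add_right (dvd_refl k)
    by_cases hi : k ∣ i
    · rw [if_pos (h.2 hi), if_pos hi, mul_comm]
    · rw [if_neg (h.not.2 hi), if_neg hi, mul_zero]

theorem geom_mul_one_sub (c : ℤ) (hk : 0 < k) : geom c k * (1 - C c * X ^ k) = 1 := by
  linear_combination geom_eq c hk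

theorem etaFactor_eq (m : ℕ) (hk : 0 < k) : etaFactor m k = geom 1 k ^ necklaceCount k m := by
  have h1 : (1 - X ^ k : ℤ⟦X⟧) * invOfUnit (1 - X ^ k) 1 = 1 :=
    mul_invOfUnit _ _ (by simp [hk.ne'])
  have h2 := geom_mul_one_sub 1 hk
  rw [map_one, one_mul] at h2
  have h3 : invOfUnit (1 - X ^ k : ℤ⟦X⟧) 1 = geom 1 k := by
    linear_combination geom 1 k * h1 - invOfUnit (1 - X ^ k : ℤ⟦X⟧) 1 * h2
  rw [etaFactor, h3]

theorem coeff_natCast_mul (j N : ℕ) (P : ℤ⟦X⟧) : coeff j ((N : ℤ⟦X⟧) * P) = N * coeff j P := by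
  rw [← nsmul_eq_mul, map_nsmul, nsmul_eq_mul]

theorem coeff_zero_geom (c : ℤ) (k : ℕ) : coeff 0 (geom c k) = 1 := by
  simp [coeff_geom]

theorem X_mul_derivative_X_pow (k : ℕ) : X * d⁄dX ℤ (X ^ k : ℤ⟦X⟧) = (k : ℤ⟦X⟧) * X ^ k := by
  rw [derivative_pow, derivative_X]
  cases k with
  | zero => simp
  | succ k => rw [Nat.add_sub_cancel]; ring

/-- `A` is the logarithmic derivative of `P`, for the derivation `t d/dt`. -/
def HasLogDeriv (P A : ℤ⟦X⟧) : Prop := X * d⁄dX ℤ P = P * A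

theorem HasLogDeriv.mul {P Q A B : ℤ⟦X⟧} (hP : HasLogDeriv P A) (hQ : HasLogDeriv Q B) :
    HasLogDeriv (P * Q) (A + B) := by
  unfold HasLogDeriv at *
  rw [Derivation.leibniz, smul_eq_mul, smul_eq_mul]
  linear_combination P * hQ + Q * hP

theorem HasLogDeriv.one : HasLogDeriv 1 0 := by
  simp [HasLogDeriv]

theorem HasLogDeriv.prod {ι : Type*} (s : Finset ι) {P A : ι → ℤ⟦X⟧}
    (h : ∀ i ∈ s, HasLogDeriv (P i) (A i)) : HasLogDeriv (∏ i ∈ s, P i) (∑ i ∈ s, A i) := by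
  classical
  induction s using Finset.induction_on with
  | empty => simpa using HasLogDeriv.one
  | insert a s ha ih =>
    rw [Finset.prod_insert ha, Finset.sum_insert ha]
    exact (h a (Finset.mem_insert_self a s)).mul
      (ih fun i hi => h i (Finset.mem_insert_of_mem hi))

theorem HasLogDeriv.pow {P A : ℤ⟦X⟧} (h : HasLogDeriv P A) (N : ℕ) :
    HasLogDeriv (P ^ N) (N * A) := by
  simpa using HasLogDeriv.prod (Finset.range N) (P := fun _ => P) (A := fun _ => A) fun _ _ => h

/-- For P = 1/(1 - c t^k), the logarithmic derivative k c t^k P equals k (P - 1). -/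
theorem hasLogDeriv_geom (c : ℤ) (hk : 0 < k) :
    HasLogDeriv (geom c k) ((k : ℤ⟦X⟧) * (geom c k - 1)) := by
  unfold HasLogDeriv
  have h1 := geom_mul_one_sub c hk
  have h2 := congrArg (fun P => X * d⁄dX ℤ P) h1
  simp only [Derivation.leibniz, smul_eq_mul, map_sub, derivative_one, derivative_C, mul_zero,
    zero_sub, add_zero] at h2
  have h3 := X_mul_derivative_X_pow k
  linear_combination geom c k * h2 + (geom c k ^ 2 * C c) * h3
    + (-X * d⁄dX ℤ (geom c k) - (k : ℤ⟦X⟧) * geom c k) * h1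

/-- As A has no constant term, (j + 1) times the coefficient of P at j + 1 is determined by A and
the earlier coefficients of P; integers allow cancelling j + 1. -/
theorem coeff_eq_of_hasLogDeriv {P Q A B : ℤ⟦X⟧} (hP : HasLogDeriv P A) (hQ : HasLogDeriv Q B)
    (h0 : coeff 0 P = coeff 0 Q) {K : ℕ} (hA : coeff 0 A = 0)
    (hAB : ∀ j ≤ K, coeff j A = coeff j B) : ∀ j ≤ K, coeff j P = coeff j Q := by
  intro j
  induction j using Nat.strong_induction_on with
  | _ j ih =>
    intro hj
    cases j with
    | zero => exact h0
    | succ j =>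
      have key : ∀ {P A : ℤ⟦X⟧}, HasLogDeriv P A → coeff 0 A = 0 →
          coeff (j + 1) P * (j + 1)
            = ∑ p ∈ Finset.HasAntidiagonal.antidiagonal j, coeff p.1 P * coeff (p.2 + 1) A := by
        intro P A h hA
        have h1 := congrArg (coeff (j + 1)) h
        rw [coeff_succ_X_mul, coeff_derivative, coeff_mul,
          Finset.Nat.sum_antidiagonal_succ', hA, mul_zero, zero_add] at h1
        exact_mod_cast h1
      have hB : coeff 0 B = 0 := by rw [← hAB 0 (Nat.zero_le K), hA]
      have h1 := key hP hA
      refine mul_right_cancel₀ (b := (j + 1 : ℤ)) (by positivity) ?_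
      rw [key hP hA, key hQ hB]
      refine Finset.sum_congr rfl fun p hp => ?_
      have h := Finset.HasAntidiagonal.mem_antidiagonal.1 hp
      rw [ih p.1 (by omega) (by omega), hAB (p.2 + 1) (by omega)]

theorem sum_range_ite_dvd (f : ℕ → ℤ) {j K : ℕ} (hj : 0 < j) (hK : j ≤ K) :
    ∑ k ∈ Finset.range K, (if k + 1 ∣ j then f (k + 1) else 0) = ∑ k ∈ j.divisors, f k := by
  rw [← Finset.sum_filter]
  refine Finset.sum_bij' (fun k _ => k + 1) (fun k _ => k - 1) ?_ ?_ ?_ ?_ ?_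
  · intro k hk
    exact Nat.mem_divisors.2 ⟨(Finset.mem_filter.1 hk).2, hj.ne'⟩
  · intro k hk
    have h1 := Nat.pos_of_mem_divisors hk
    have h2 := Nat.divisor_le hk
    rw [Finset.mem_filter, Finset.mem_range, Nat.sub_add_cancel h1]
    exact ⟨by omega, Nat.dvd_of_mem_divisors hk⟩
  · intro k _
    exact Nat.add_sub_cancel k 1
  · intro k hk
    exact Nat.sub_add_cancel (Nat.pos_of_mem_divisors hk)
  · intro k _
    rfl

/-- The logarithmic derivatives agree up to degree K, because all divisors of j ≤ K index factors of
the truncated products. -/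
theorem coeff_prod_etaFactor (m d K : ℕ) (hd : d ≤ K) :
    coeff d (∏ k ∈ Finset.range K, etaFactor m (k + 1))
      = coeff d (∏ k ∈ Finset.range K, geom m (k + 1)) := by
  refine coeff_eq_of_hasLogDeriv
    (HasLogDeriv.prod _ (A := fun k => necklaceCount (k + 1) m *
      (((k + 1 : ℕ) : ℤ⟦X⟧) * (geom 1 (k + 1) - 1))) fun k _ => ?_)
    (HasLogDeriv.prod _ fun k _ => hasLogDeriv_geom m k.succ_pos) ?_ (K := K) ?_ ?_ d hd
  · rw [etaFactor_eq m k.succ_pos]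
    exact (hasLogDeriv_geom 1 k.succ_pos).pow _
  · simp only [coeff_zero_eq_constantCoeff, map_prod]
    refine Finset.prod_congr rfl fun k _ => ?_
    rw [etaFactor_eq m k.succ_pos, map_pow, ← coeff_zero_eq_constantCoeff, coeff_zero_geom,
      coeff_zero_eq_constantCoeff, ← coeff_zero_eq_constantCoeff_apply, coeff_zero_geom, one_pow]
  · rw [map_sum]
    refine Finset.sum_eq_zero fun k _ => ?_
    rw [coeff_natCast_mul, coeff_natCast_mul, map_sub, coeff_zero_geom, coeff_zero_one, sub_self,
      mul_zero, mul_zero]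
  · intro j hj
    rw [map_sum, map_sum]
    rcases Nat.eq_zero_or_pos j with rfl | h0
    · refine Finset.sum_congr rfl fun k _ => ?_
      simp only [coeff_natCast_mul, map_sub, coeff_zero_geom, coeff_zero_one, sub_self, mul_zero]
    · simp only [coeff_natCast_mul, map_sub, coeff_geom, coeff_one, if_neg h0.ne', sub_zero, one_pow, mul_ite,
        mul_one, mul_zero]
      rw [sum_range_ite_dvd (fun k => (necklaceCount k m : ℤ) * (k : ℤ)) h0 hj,
        sum_range_ite_dvd (fun k => (k : ℤ) * (m : ℤ) ^ (j / k)) h0 hj]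
      have h := congrArg (Nat.cast (R := ℤ)) (sum_divisors_necklaceCount j m)
      push_cast at h
      rw [← h]
      exact Finset.sum_congr rfl fun k _ => mul_comm _ _

/-- The factor of index k is 1 modulo t^(k+1), so the orders of the deviations from 1 tend to
infinity. -/
theorem multipliable_etaFactor (m : ℕ) : Multipliable fun k : ℕ => etaFactor m (k + 1) := by
  have h : (fun k : ℕ => etaFactor m (k + 1)) = fun k => 1 + (etaFactor m (k + 1) - 1) := by
    funext k; ring
  rw [h]
  refine WithPiTopology.multipliable_one_add_of_tendsto_order_atTop_nhds_top (R := ℤ) (ι := ℕ) ?_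
  refine ENat.tendsto_nhds_top_iff_natCast_lt.mpr fun n : ℕ =>
    (Filter.eventually_ge_atTop n).mono fun k hk => ?_
  have hdvd : X ^ (k + 1) ∣ etaFactor m (k + 1) - 1 := by
    rw [etaFactor_eq m k.succ_pos]
    refine Dvd.dvd.trans ⟨C 1 * geom 1 (k + 1), ?_⟩ (sub_one_dvd_pow_sub_one _ _)
    linear_combination geom_eq 1 (Nat.add_one_pos k)
  have h2 : ((k + 1 : ℕ) : ℕ∞) ≤ (etaFactor m (k + 1) - 1).order :=
    nat_le_order _ _ (X_pow_dvd_iff.1 hdvd)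
  exact lt_of_lt_of_le (by exact_mod_cast Nat.lt_succ_of_le hk) h2

/-- The integers are discrete, so a convergent coefficient is eventually constant; identities of
infinite products reduce to finite ones. -/
theorem eventually_coeff_prod {f : ℕ → ℤ⟦X⟧} {g : ℤ⟦X⟧} (h : HasProd f g) (d : ℕ) :
    ∀ᶠ K in Filter.atTop, coeff d (∏ k ∈ Finset.range K, f k) = coeff d g := by
  have h1 := (WithPiTopology.tendsto_iff_coeff_tendsto ℤ _ _ _).1 h.tendsto_prod_nat d
  rw [nhds_discrete, Filter.tendsto_pure] at h1
  exact h1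

theorem hasSum_geom (c : ℤ) (i : ℕ) :
    HasSum (fun j : ℕ => C (c ^ (j + 1)) * (X : ℤ⟦X⟧) ^ ((i + 1) * (j + 1)))
      (geom c (i + 1) - 1) := by
  rw [WithPiTopology.hasSum_iff_hasSum_coeff]
  intro d
  simp only [coeff_C_mul, coeff_X_pow, map_sub, coeff_geom, coeff_one]
  by_cases h : i + 1 ∣ d ∧ d ≠ 0
  · obtain ⟨⟨j, rfl⟩, h0⟩ := h
    obtain ⟨j, rfl⟩ := Nat.exists_eq_succ_of_ne_zero (right_ne_zero_of_mul h0)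
    rw [if_pos (dvd_mul_right _ _), if_neg h0, Nat.mul_div_cancel_left _ i.succ_pos, sub_zero]
    convert hasSum_single j ?_ using 1
    · simp
    · intro j' hj'
      rw [if_neg, mul_zero]
      intro h
      exact hj' (by have := Nat.eq_of_mul_eq_mul_left i.succ_pos h; omega)
  · convert hasSum_zero using 1
    · funext j
      rw [if_neg, mul_zero]
      rintro rfl
      exact h ⟨dvd_mul_right _ _, by positivity⟩
    · rcases eq_or_ne d 0 with rfl | h0
      · simp
      · rw [if_neg fun h1 => h ⟨h1, h0⟩, if_neg h0, sub_zero]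

/-- In ∏ 1/(1 - m t^k), a part used c times has weight m^c, so a partition has weight m^(number of
parts). -/
theorem coeff_eta (m d : ℕ) :
    coeff d (eta m) = ∑ p : d.Partition, (m : ℤ) ^ p.parts.card := by
  have h1 := eventually_coeff_prod (multipliable_etaFactor m).hasProd d
  have h2 := eventually_coeff_prod (Nat.Partition.hasProd_genFun (fun _ c => (m : ℤ) ^ c)) d
  obtain ⟨K, hK1, hK2, hK⟩ := (h1.and (h2.and (Filter.eventually_ge_atTop d))).exists
  rw [eta, ← hK1, coeff_prod_etaFactor m d K hK]
  simp only [smul_eq_C_mul, (hasSum_geom _ _).tsum_eq, add_sub_cancel] at hK2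
  rw [hK2, Nat.Partition.coeff_genFun]
  refine Finset.sum_congr rfl fun p _ => ?_
  rw [Finsupp.prod, Finset.prod_pow_eq_pow_sum]
  simp

end GeometricSeries

/-! ### Multisets of necklaces -/

section Multisets

open PowerSeries

variable {α : Type*} (w : α → ℕ)

theorem sum_map_eq_sum_mul_count [DecidableEq α] {S : Finset α} {s : Multiset α}
    (hs : ∀ a ∈ s, a ∈ S) : (s.map w).sum = ∑ a ∈ S, w a * s.count a := by
  rw [Finset.sum_multiset_map_count]
  refine Finset.sum_subset_zero_on_sdiff (fun a ha => hs a (Multiset.mem_toFinset.1 ha))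
    (fun a ha => ?_) fun a _ => mul_comm _ _
  rw [Multiset.count_eq_zero_of_notMem, mul_zero]
  exact fun h => (Finset.mem_sdiff.1 ha).2 (Multiset.mem_toFinset.2 h)

/-- The product of the series `1 / (1 - t^(w a))` counts multisets by total weight. -/
theorem coeff_prod_geom_weight {S : Finset α} (hw : ∀ a ∈ S, 0 < w a) (d : ℕ) :
    coeff d (∏ a ∈ S, geom 1 (w a))
      = (Nat.card {s : Multiset α // (∀ a ∈ s, a ∈ S) ∧ (s.map w).sum = d} : ℤ) := by
  classical
  rw [coeff_prod]
  simp only [coeff_geom, one_pow]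
  simp only [Finset.prod_ite_zero, Finset.prod_const_one]
  rw [Finset.sum_boole, ← Fintype.card_coe, ← Nat.card_eq_fintype_card, Nat.cast_inj]
  -- A multiset corresponds to the exponents w a * count a taken from the factors; positivity of w a
  -- recovers the count.
  refine Nat.card_congr (Equiv.symm (Equiv.ofBijective (fun s => ⟨Finsupp.onFinset S
    (fun a => w a * s.1.count a) fun a ha => s.2.1 a (Multiset.count_ne_zero.1
      (right_ne_zero_of_mul ha)), ?_⟩) ⟨?_, ?_⟩))
  · rw [Finset.mem_filter, Finset.mem_finsuppAntidiag]
    refine ⟨⟨?_, Finsupp.support_onFinset_subset⟩, fun a _ => dvd_mul_right _ _⟩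
    exact (sum_map_eq_sum_mul_count w s.2.1).symm.trans s.2.2
  · intro s t h
    refine Subtype.ext (Multiset.ext.2 fun a => ?_)
    by_cases ha : a ∈ S
    · exact Nat.eq_of_mul_eq_mul_left (hw a ha) (DFunLike.congr_fun (Subtype.ext_iff.1 h) a)
    · rw [Multiset.count_eq_zero_of_notMem fun h => ha (s.2.1 a h),
        Multiset.count_eq_zero_of_notMem fun h => ha (t.2.1 a h)]
  · rintro ⟨g, hg⟩
    obtain ⟨⟨hsum, hsupp⟩, hdvd⟩ := (Finset.mem_filter.1 hg).imp_left Finset.mem_finsuppAntidiag.1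
    set s : Multiset α := ∑ a ∈ S, Multiset.replicate (g a / w a) a with hs
    have hcount : ∀ a, w a * s.count a = g a := fun a => by
      rw [hs, Multiset.count_sum']
      simp only [Multiset.count_replicate]
      rw [Finset.sum_ite_eq']
      by_cases ha : a ∈ S
      · rw [if_pos ha, Nat.mul_div_cancel' (hdvd a ha)]
      · rw [if_neg ha, mul_zero, eq_comm]
        exact Finsupp.notMem_support_iff.1 fun h => ha (hsupp h)
    have hmem : ∀ a ∈ s, a ∈ S := fun a ha => by
      obtain ⟨b, hb, hab⟩ := Multiset.mem_sum.1 ha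
      rwa [Multiset.eq_of_mem_replicate hab]
    refine ⟨⟨s, hmem, ?_⟩, Subtype.ext (Finsupp.ext hcount)⟩
    rw [sum_map_eq_sum_mul_count w hmem, ← hsum]
    exact Finset.sum_congr rfl fun a _ => hcount a

/-- The power N_k(m) provides one geometric series per necklace of length k. Truncating at K ≥ d
loses nothing, since no necklace in the multiset has more than d beads. -/
theorem coeff_eta_eq_card (m d : ℕ) : coeff d (eta m) = (Nat.card {s : Multiset (Cycle (Fin m)) //
    Cycle.nil ∉ s ∧ (s.map Cycle.length).sum = d} : ℤ) := by
  classical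
  obtain ⟨K, hK1, hK⟩ := ((eventually_coeff_prod (multipliable_etaFactor m).hasProd d).and
    (Filter.eventually_ge_atTop d)).exists
  rw [eta, ← hK1]
  have hprod : ∏ k ∈ Finset.range K, etaFactor m (k + 1)
      = ∏ c ∈ (Finset.range K).biUnion fun k => (finite_cycles k m).toFinset,
        geom 1 c.length := by
    rw [Finset.prod_biUnion]
    · refine Finset.prod_congr rfl fun k _ => ?_
      rw [Finset.prod_congr rfl fun c hc => by
        rw [show c.length = k + 1 from (finite_cycles k m).mem_toFinset.1 hc], Finset.prod_const,
        etaFactor_eq m k.succ_pos, ← card_cycles]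
      congr 1
      exact Nat.card_eq_card_finite_toFinset (finite_cycles k m)
    · intro i _ j _ hij
      refine Finset.disjoint_left.2 fun c hi hj => hij ?_
      have h1 : c.length = i + 1 := (finite_cycles i m).mem_toFinset.1 hi
      have h2 : c.length = j + 1 := (finite_cycles j m).mem_toFinset.1 hj
      omega
  have hmem : ∀ c, c ∈ (Finset.range K).biUnion (fun k => (finite_cycles k m).toFinset) ↔
      0 < c.length ∧ c.length ≤ K := fun c => by
    simp only [Finset.mem_biUnion, Finset.mem_range, Set.Finite.mem_toFinset, Set.mem_ofPred_eq]
    exact ⟨fun ⟨k, h1, h2⟩ => by omega, fun h => ⟨c.length - 1, by omega, by omega⟩⟩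
  rw [hprod, coeff_prod_geom_weight _ (fun c hc => ((hmem c).1 hc).1)]
  refine congrArg Nat.cast (Nat.card_congr (Equiv.subtypeEquivRight fun s =>
    and_congr_left fun hs => ?_))
  have hnil : ∀ c : Cycle (Fin m), c = Cycle.nil ↔ c.length = 0 := fun c => by
    induction c using Quotient.inductionOn with
    | _ l => exact (Cycle.coe_eq_coe.trans List.isRotated_nil_iff).trans List.length_eq_zero_iff.symm
  constructor
  · intro h h0
    exact absurd ((hmem _).1 (h _ h0)).1 (by simp)
  · intro h c hc
    refine (hmem c).2 ⟨Nat.pos_of_ne_zero fun h0 => h ((hnil c).2 h0 ▸ hc), ?_⟩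
    refine le_trans ?_ hK
    rw [← hs]
    exact Multiset.single_le_sum (fun _ _ => Nat.zero_le _) _ (Multiset.mem_map_of_mem _ hc)

end Multisets

/-! ### The sum of the squares of the multiplicities -/

section SumOfSquares

open PowerSeries

/-- There are no bijections between the cell sets, so the trace is over the zero space. This leaves
finitely many nonzero terms in each degree. -/
theorem lrCoeff_eq_zero_of_card_lt {m n : ℕ} {lam : YoungDiagram} {mu : Fin m → YoungDiagram}
    (hlam : lam.colLen 0 ≤ n) (hmu : ∀ j, (mu j).colLen 0 ≤ n) {j : Fin m}
    (hj : lam.card < (mu j).card) : lrCoeff n lam mu = 0 := by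
  have : IsEmpty (lam.cells ≃ (Σ j, (mu j).cells)) := ⟨fun e => by
    have h := Fintype.card_le_of_injective (fun c : (mu j).cells => e.symm ⟨j, c⟩)
      fun a b hab => by simpa using hab
    simp only [Fintype.card_coe] at h
    exact absurd h (Nat.not_le.2 hj)⟩
  have h := lrCoeff_eq_traceMult n lam mu hlam hmu
  rw [traceMult, Subsingleton.elim (sandwich (tupleIdem mu) (youngIdem lam)) 0, map_zero] at h
  exact_mod_cast h

theorem hasSum_lrCoeff_sq (m : ℕ) (n : YoungDiagram → (Fin m → YoungDiagram) → ℕ)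
    (hn : ∀ lam mu, lam.colLen 0 ≤ n lam mu ∧ ∀ j, (mu j).colLen 0 ≤ n lam mu) :
    HasSum (fun p : YoungDiagram × (Fin m → YoungDiagram) =>
      monomial p.1.card ((lrCoeff (n p.1 p.2) p.1 p.2 : ℤ) ^ 2)) (eta m) := by
  classical
  rw [WithPiTopology.hasSum_iff_hasSum_coeff]
  intro d
  simp only [coeff_monomial]
  have hval : coeff d (eta m) = ∑ p ∈ (diagramsLE d).filter (fun lam => lam.card = d) ×ˢ
      Fintype.piFinset (fun _ : Fin m => diagramsLE d),
      if d = p.1.card then (lrCoeff (n p.1 p.2) p.1 p.2 : ℤ) ^ 2 else 0 := by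
    -- The traces are complex numbers, so the identity is proved in ℂ and pulled back to ℤ.
    have h : ((∑ p : d.Partition, (m : ℤ) ^ p.parts.card : ℤ) : ℂ) = ((∑ p ∈
        (diagramsLE d).filter (fun lam => lam.card = d) ×ˢ
        Fintype.piFinset (fun _ : Fin m => diagramsLE d),
        if d = p.1.card then (lrCoeff (n p.1 p.2) p.1 p.2 : ℤ) ^ 2 else 0 : ℤ) : ℂ) := by
      push_cast
      rw [← sum_traceMult_sq, Finset.sum_product]
      refine (Finset.sum_subtype _ (fun lam => ?_) (fun lam => ∑ mu ∈ Fintype.piFinset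
        (fun _ : Fin m => diagramsLE d), traceMult lam mu ^ 2)).symm.trans
        (Finset.sum_congr rfl fun lam hlam => Finset.sum_congr rfl fun mu _ => ?_)
      · rw [Finset.mem_filter, mem_diagramsLE]
        exact ⟨fun h => h.2, fun h => ⟨h.le, h⟩⟩
      · rw [if_pos (Finset.mem_filter.1 hlam).2.symm,
          lrCoeff_eq_traceMult _ _ _ (hn lam mu).1 (hn lam mu).2]
    rw [coeff_eta]
    exact_mod_cast h
  rw [hval]
  refine hasSum_sum_of_ne_finset_zero fun p hp => ?_
  split_ifs with hd
  · rw [Finset.mem_product, Finset.mem_filter, mem_diagramsLE, Fintype.mem_piFinset] at hp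
    simp only [mem_diagramsLE] at hp
    have h : ∃ j, d < (p.2 j).card := by
      by_contra! h
      exact hp ⟨⟨hd.ge, hd.symm⟩, h⟩
    obtain ⟨j, hj⟩ := h
    rw [lrCoeff_eq_zero_of_card_lt (hn _ _).1 (hn _ _).2 (hd ▸ hj)]
    norm_num
  · rfl

end SumOfSquares

end LRSquares

end

theorem mainTheorem6 (m : ℕ)
    (n : YoungDiagram → (Fin m → YoungDiagram) → ℕ)
    (hn : ∀ lam mu, lam.colLen 0 ≤ n lam mu ∧ ∀ j, (mu j).colLen 0 ≤ n lam mu) :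
    (∀ k : ℕ, 1 ≤ k →
      (LRSquares.necklaceCount k m : ℚ)
          = (1 / k) * ∑ r ∈ k.divisors, (r.totient : ℚ) * (m : ℚ) ^ (k / r) ∧
        Nat.card {c : Cycle (Fin m) // c.length = k} = LRSquares.necklaceCount k m) ∧
    Multipliable (fun k : ℕ => LRSquares.etaFactor m (k + 1)) ∧
    (∀ d : ℕ, PowerSeries.coeff d (LRSquares.eta m) =
      (Nat.card {s : Multiset (Cycle (Fin m)) //
        Cycle.nil ∉ s ∧ (s.map Cycle.length).sum = d} : ℤ)) ∧
    HasSum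
      (fun p : YoungDiagram × (Fin m → YoungDiagram) =>
        PowerSeries.monomial p.1.card ((LRSquares.lrCoeff (n p.1 p.2) p.1 p.2 : ℤ) ^ 2))
      (LRSquares.eta m) := by
  refine ⟨fun k hk => ?_, LRSquares.multipliable_etaFactor m, LRSquares.coeff_eta_eq_card m,
    LRSquares.hasSum_lrCoeff_sq m n hn⟩
  obtain ⟨k, rfl⟩ := Nat.exists_eq_add_of_le' hk
  exact ⟨LRSquares.necklaceCount_eq_rat k m, LRSquares.card_cycles k m⟩
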